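/- \textbf{Model.} There are $n$ parties, at most $f$ of them Byzantine, with perfect (unforgeable) digital signatures, and $n/3<f<n/2$. A bound $\Delta>0$ on the message delays between honest parties is known. Each execution has an actual bound $\delta\in[0,\Delta]$, unknown to the parties: every message between two honest parties is received within time $\delta$, with a delay chosen by the adversary. The start is unsynchronized: each party has a drift-free local clock that shows $0$ when the party starts, and the start times of any two honest parties differ by at most $\sigma\le\delta$; in the protocol the parties use $\sigma=\Delta$. A Byzantine broadcast (BB) protocol with designated broadcaster $L$ satisfies \emph{agreement} (no two honest parties commit different values), \emph{validity} (if $L$ is honest, all honest parties commit the input of $L$ and terminate) and \emph{termination} (all honest parties commit and terminate). It has \emph{good-case latency} $T$ if, in all executions in which $L$ is honest, all honest parties commit within time $T$ since $L$ starts the protocol. A party \emph{detects equivocation} by time $t$ if by then (time $t$ included) it has received messages containing different values signed by $L$. \textbf{The $(\Delta+1.5\delta)$-BB protocol.} It uses as a primitive any deterministic authenticated protocol that solves Byzantine agreement (BA) with at most $f$ Byzantine parties in this model: all honest outputs are equal; if all honest inputs equal $v$, all honest parties output $v$; every honest party outputs and terminates. Initially $\mathtt{lock}=\bot$ and $\mathtt{rank}=\Delta+1$.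 \begin{enumerate} \item Propose. $L$ with input $v$ sends $\langle\mathtt{propose},v\rangle_L$ to all parties when it starts. \item Forward. When a party receives its first valid proposal $\langle\mathtt{propose},v\rangle_L$, from any party, at local time $t_{prop}$, it forwards this proposal to all parties. When it receives a proposal directly from $L$ at local time at most $\Delta+\sigma$, it sets $\mathtt{direct}$-$\mathtt{rcv}=true$. \item Vote. For every $d\in[0,\Delta]$, at local time $t_{prop}+\Delta-0.5d$, if party $i$ has not detected equivocation, it sends $\langle\mathtt{vote},d,\langle\mathtt{propose},v\rangle_L\rangle_i$ to all parties. \item Commit and lock. When a party has received votes of $f+1$ different signers for the same $d\in[0,\Delta]$ and $v$, at local time $t_{votes}$, it forwards $f+1$ such votes. (a) If $t_{votes}-t_{prop}\le\Delta+1.5d$, it detects no equivocation until local time $t_{prop}+\Delta+0.5d$, and $\mathtt{direct}$-$\mathtt{rcv}=true$, it commits $v$, at local time $\max(t_{votes},\,t_{prop}+\Delta+0.5d)$. (b) If $t_{votes}-t_{prop}\le 4.5\Delta$ and $\mathtt{rank}>d$, it sets $\mathtt{lock}=v$ and $\mathtt{rank}=d$. \item Byzantine agreement. At local time $6.5\Delta+2\sigma$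 it invokes the BA with input $\mathtt{lock}$. If it has not committed, it commits the output of the BA (possibly the default value $\bot$). It terminates when the BA does. \end{enumerate} \textbf{Theorem.} Let $n/3<f<n/2$. The $(\Delta+1.5\delta)$-BB protocol solves Byzantine broadcast in the synchronous authenticated model with unsynchronized start, and has good-case latency $\Delta+1.5\delta$. This is optimal: if there are at least two values, and a deterministic authenticated protocol solves Byzantine broadcast in this model and has good-case latency $T(\delta)$, then $T(\delta)\ge\Delta+1.5\delta$ for every $\delta\in(0,\Delta]$. -/

import Mathlib

open Set

universe u w

noncomputable section

/-! ### The synchronous authenticated network model -/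

/-- Who is honest and when the parties start, in an execution with actual delay bound `δ`.
Times are global; the local clock of `i` shows `t - start i` at global time `t` (no drift).
Unsynchronized start: the clock skew between honest parties is some `σ ≤ δ`. -/
structure Setting (n f : ℕ) (δ : ℝ) where
  honest : Finset (Fin n)
  card_honest : n ≤ honest.card + f
  start : Fin n → ℝ
  skew : ∀ i ∈ honest, ∀ j ∈ honest, |start i - start j| ≤ δ

/-- The same setting for a subroutine that every party invokes at its local time `c`. -/
def Setting.shift {n f : ℕ} {δ : ℝ} (S : Setting n f δ) (c : ℝ) : Setting n f δ where
  honest := S.honest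
  card_honest := S.card_honest
  start := fun i => S.start i + c
  skew := by
    intro i hi j hj
    simpa using S.skew i hi j hj

/-- What a party has received: triples (local time of receipt, sender, message). -/
abbrev History (n : ℕ) (M : Type*) := Set (ℝ × Fin n × M)

/-- A deterministic authenticated protocol for `n` parties. At local time `t`, a party with a given
input sends the messages `send` to the named receivers, has decided on `output` (if this is not
`none`), and has halted if `halt`; all are evaluated on the history up to and including time `t`.
`sigs m` is the set of signatures contained in `m`, each given by the signer and the signed
statement. A party can create only its own signatures; every other signature that it sends must have
been received. -/
structure Protocol (n : ℕ) (I O : Type u) where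
  Msg : Type w
  Stmt : Type w
  sigs : Msg → Set (Fin n × Stmt)
  send : Fin n → I → History n Msg → ℝ → Set (Fin n × Msg)
  output : Fin n → I → History n Msg → ℝ → Option O
  halt : Fin n → I → History n Msg → ℝ → Prop
  no_forgery : ∀ i x h t j m, (j, m) ∈ send i x h t → ∀ k s, (k, s) ∈ sigs m →
    k = i ∨ ∃ τ j' m', (τ, j', m') ∈ h ∧ (k, s) ∈ sigs m'

namespace Protocol

variable {n f : ℕ} {δ : ℝ} {I O : Type u} (P : Protocol.{u, w} n I O)

/-- `rcv i j m = some r`: party `i` receives `m` from `j`, for the first time at global time `r`.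
`view` is the local history of `i` up to global time `t`. -/
def view (S : Setting n f δ) (rcv : Fin n → Fin n → P.Msg → Option ℝ) (i : Fin n) (t : ℝ) :
    History n P.Msg :=
  {e | ∃ r, rcv i e.2.1 e.2.2 = some r ∧ r ≤ t ∧ e.1 = r - S.start i}

/-- The honest party `i` has started by time `t` and has not halted before `t`. -/
def Active (S : Setting n f δ) (x : Fin n → I) (rcv : Fin n → Fin n → P.Msg → Option ℝ)
    (i : Fin n) (t : ℝ) : Prop :=
  S.start i ≤ t ∧
    ∀ t', S.start i ≤ t' → t' < t → ¬ P.halt i (x i) (P.view S rcv i t') (t' - S.start i)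

/-- The honest party `i` commits (outputs) `o` at global time `t`. -/
def Commits (S : Setting n f δ) (x : Fin n → I) (rcv : Fin n → Fin n → P.Msg → Option ℝ)
    (i : Fin n) (o : O) (t : ℝ) : Prop :=
  P.Active S x rcv i t ∧
    P.output i (x i) (P.view S rcv i t) (t - S.start i) = some o ∧
    ∀ t', S.start i ≤ t' → t' < t →
      P.output i (x i) (P.view S rcv i t') (t' - S.start i) = none

/-- The honest party `i` terminates at global time `t`. -/
def Terminates (S : Setting n f δ) (x : Fin n → I) (rcv : Fin n → Fin n → P.Msg → Option ℝ)
    (i : Fin n) (t : ℝ) : Prop :=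
  P.Active S x rcv i t ∧ P.halt i (x i) (P.view S rcv i t) (t - S.start i)

/-- The honest party `i` sends `m` to `j` at global time `t`. -/
def Sends (S : Setting n f δ) (x : Fin n → I) (rcv : Fin n → Fin n → P.Msg → Option ℝ)
    (i j : Fin n) (m : P.Msg) (t : ℝ) : Prop :=
  P.Active S x rcv i t ∧ (j, m) ∈ P.send i (x i) (P.view S rcv i t) (t - S.start i)

/-- `rcv` is an execution of `P` in which honest parties follow `P`, messages between honest parties
have delay in `[0, δ]`, Byzantine parties are arbitrary, and signatures are unforgeable. A message
that arrives before its receiver has started is received when the receiver starts; since the skew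
is at most `δ`, this respects the delay bound. -/
structure IsExecution (S : Setting n f δ) (x : Fin n → I)
    (rcv : Fin n → Fin n → P.Msg → Option ℝ) : Prop where
  after_start : ∀ i ∈ S.honest, ∀ j m r, rcv i j m = some r → S.start i ≤ r
  delivered : ∀ i ∈ S.honest, ∀ j ∈ S.honest, ∀ m t, P.Sends S x rcv j i m t →
    ∃ r, rcv i j m = some r ∧ r ≤ t + δ
  authentic : ∀ i ∈ S.honest, ∀ j ∈ S.honest, ∀ m r, rcv i j m = some r →
    ∃ t ≤ r, P.Sends S x rcv j i m t
  unforgeable : ∀ i ∈ S.honest, ∀ j m r, rcv i j m = some r →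
    ∀ k ∈ S.honest, ∀ s, (k, s) ∈ P.sigs m →
      ∃ j' m' t, t ≤ r ∧ P.Sends S x rcv k j' m' t ∧ (k, s) ∈ P.sigs m'

/-- `P` solves Byzantine agreement with at most `f` Byzantine parties under the known delay bound
`Δ`, with unsynchronized start: agreement, validity, termination. -/
def SolvesByzantineAgreement {n : ℕ} {I : Type u} (P : Protocol.{u, w} n I I) (f : ℕ) (Δ : ℝ) :
    Prop :=
  ∀ δ ∈ Icc 0 Δ, ∀ (S : Setting n f δ) (x : Fin n → I) (rcv : Fin n → Fin n → P.Msg → Option ℝ),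
    P.IsExecution S x rcv →
      (∀ i ∈ S.honest, ∀ j ∈ S.honest, ∀ o o' t t',
        P.Commits S x rcv i o t → P.Commits S x rcv j o' t' → o = o') ∧
      (∀ v, (∀ i ∈ S.honest, x i = v) → ∀ i ∈ S.honest, ∃ t, P.Commits S x rcv i v t) ∧
      (∀ i ∈ S.honest, (∃ o t, P.Commits S x rcv i o t) ∧ ∃ t, P.Terminates S x rcv i t)

end Protocol

/-! ### Byzantine broadcast and good-case latency -/

/-- What an execution of a broadcast protocol shows to the outside. `commits i o t`: party `i`
commits `o` at global time `t`, where `none` is the default value `⊥`. -/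
structure BroadcastRun (n : ℕ) (V : Type*) where
  honest : Finset (Fin n)
  start : Fin n → ℝ
  /-- the input of the broadcaster; meaningful if the broadcaster is honest -/
  input : V
  commits : Fin n → Option V → ℝ → Prop
  terminates : Fin n → ℝ → Prop

/-- `runs δ` is the set of the executions with actual delay bound `δ`, and `L` is the broadcaster. -/
def SolvesByzantineBroadcast {n : ℕ} {V : Type*} (L : Fin n) (Δ : ℝ)
    (runs : ℝ → Set (BroadcastRun n V)) : Prop :=
  ∀ δ ∈ Icc 0 Δ, ∀ R ∈ runs δ,
    (∀ i ∈ R.honest, ∀ j ∈ R.honest, ∀ o o' t t',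
      R.commits i o t → R.commits j o' t' → o = o') ∧
    (L ∈ R.honest → ∀ i ∈ R.honest,
      (∃ t, R.commits i (some R.input) t) ∧ ∃ t, R.terminates i t) ∧
    (∀ i ∈ R.honest, (∃ o t, R.commits i o t) ∧ ∃ t, R.terminates i t)

/-- If the broadcaster is honest, all honest parties commit within time `T δ` since the broadcaster
starts the protocol. -/
def HasGoodCaseLatency {n : ℕ} {V : Type*} (L : Fin n) (Δ : ℝ)
    (runs : ℝ → Set (BroadcastRun n V)) (T : ℝ → ℝ) : Prop :=
  ∀ δ ∈ Icc 0 Δ, ∀ R ∈ runs δ, L ∈ R.honest → ∀ i ∈ R.honest,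
    ∃ o t, R.commits i o t ∧ t ≤ R.start L + T δ

/-- The executions with actual delay bound `δ` of `P` used as a broadcast protocol: only the
broadcaster `L` has an input value. -/
def Protocol.broadcastRuns {n : ℕ} {V : Type u} (P : Protocol.{u, w} n (Option V) (Option V))
    (f : ℕ) (L : Fin n) (δ : ℝ) : Set (BroadcastRun n V) :=
  {R | ∃ (S : Setting n f δ) (v : V) (rcv : Fin n → Fin n → P.Msg → Option ℝ),
    P.IsExecution S (fun i => if i = L then some v else none) rcv ∧
    R = { honest := S.honest
          start := S.start
          input := v
          commits := P.Commits S (fun i => if i = L then some v else none) rcv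
          terminates := P.Terminates S (fun i => if i = L then some v else none) rcv }}

/-- In the class of deterministic authenticated protocols, none that solves Byzantine broadcast (with
`f` faults, known bound `Δ` and unsynchronized start) has good-case latency less than `T δ` at
any `δ ∈ (0, Δ]`. -/
def IsOptimalGoodCaseLatency {n : ℕ} (V : Type u) (f : ℕ) (L : Fin n) (Δ : ℝ) (T : ℝ → ℝ) :
    Prop :=
  ∀ P : Protocol.{u, w} n (Option V) (Option V),
    SolvesByzantineBroadcast L Δ (P.broadcastRuns f L) →
      ∀ T', HasGoodCaseLatency L Δ (P.broadcastRuns f L) T' → ∀ δ ∈ Ioc 0 Δ, T δ ≤ T' δ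

/-! ### The (Δ + 1.5δ)-BB protocol -/

namespace DeltaBB

/-- `propose v` is `⟨propose, v⟩_L`, signed by the broadcaster `L`; `vote d v k` is
`⟨vote, d, ⟨propose, v⟩_L⟩_k`, signed by `k` and containing the signed proposal. -/
inductive Msg (n : ℕ) (V : Type u) : Type u
  | propose (v : V) : Msg n V
  | vote (d : ℝ) (v : V) (k : Fin n) : Msg n V

/-- The value signed by the broadcaster that a message contains. -/
def Msg.value {n : ℕ} {V : Type u} : Msg n V → V
  | .propose v => v
  | .vote _ v _ => v

/-- The events of an execution, with the Byzantine agreement primitive `BA`. All times are global.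
* `rcv i j m = some r`: `i` receives `m` from `j` (who need not be a signer of `m`), for the first
  time at time `r`; further copies have no effect. `baRcv` is the same for the messages of `BA`.
* `prop i = some (t, v)`: the first valid proposal that `i` receives has value `v`, received at `t`.
* `fwd i d v`: the signers of the `f + 1` votes for `d`, `v` that `i` forwards.
* `lock i`: the value of `lock` at `i` when it invokes `BA`. -/
structure Trace {n : ℕ} {V : Type u} (BA : Protocol.{u, w} n (Option V) (Option V))
    (f : ℕ) (δ : ℝ) where
  setting : Setting n f δ
  input : V
  rcv : Fin n → Fin n → Msg n V → Option ℝ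
  prop : Fin n → Option (ℝ × V)
  fwd : Fin n → ℝ → V → Finset (Fin n)
  lock : Fin n → Option V
  baRcv : Fin n → Fin n → BA.Msg → Option ℝ

/-- The clock skew parameter `σ` that the parties use is `Δ`. -/
def sigma (Δ : ℝ) : ℝ := Δ

/-- The local time at which `BA` is invoked. -/
def baTime (Δ : ℝ) : ℝ := 13 / 2 * Δ + 2 * sigma Δ

namespace Trace

variable {n : ℕ} {V : Type u} {BA : Protocol.{u, w} n (Option V) (Option V)} {f : ℕ} {δ : ℝ}
variable (E : Trace BA f δ) (Δ : ℝ) (L : Fin n)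

/-- The instance of `BA` gives the output `o` to `i` at time `t`. -/
def BAOutputs (i : Fin n) (o : Option V) (t : ℝ) : Prop :=
  BA.Commits (E.setting.shift (baTime Δ)) E.lock E.baRcv i o t

/-- `i` terminates at time `t`: its instance of `BA` has terminated, with an output by then. -/
def Terminates (i : Fin n) (t : ℝ) : Prop :=
  BA.Terminates (E.setting.shift (baTime Δ)) E.lock E.baRcv i t ∧ ∃ o, ∃ t' ≤ t, E.BAOutputs Δ i o t'

/-- Party `i` has not terminated before time `t`. -/
def Running (i : Fin n) (t : ℝ) : Prop :=
  ∀ t', E.Terminates Δ i t' → t ≤ t'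

/-- Party `i` detects equivocation by time `t`: it has received messages containing different
values signed by the broadcaster. -/
def Detects (i : Fin n) (t : ℝ) : Prop :=
  ∃ j m r j' m' r', E.rcv i j m = some r ∧ r ≤ t ∧ E.rcv i j' m' = some r' ∧ r' ≤ t ∧
    m.value ≠ m'.value

/-- The flag `direct-rcv` of `i` is true at time `t`: by then `i` has received a proposal directly
from the broadcaster, at local time at most `Δ + σ`. -/
def DirectRcv (i : Fin n) (t : ℝ) : Prop :=
  ∃ v r, E.rcv i L (.propose v) = some r ∧ r ≤ t ∧ r - E.setting.start i ≤ Δ + sigma Δ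

/-- The parties whose votes for `d`, `v` have been received by `i` by time `t`, from any sender. -/
def signers (i : Fin n) (d : ℝ) (v : V) (t : ℝ) : Finset (Fin n) :=
  open Classical in
  Finset.univ.filter fun k => ∃ j r, E.rcv i j (.vote d v k) = some r ∧ r ≤ t

/-- `t` is the time at which `i` has received `f + 1` votes of the same `d ∈ [0, Δ]` and `v`. -/
def VotesAt (i : Fin n) (d : ℝ) (v : V) (t : ℝ) : Prop :=
  d ∈ Icc 0 Δ ∧ f + 1 ≤ (E.signers i d v t).card ∧ ∀ t' < t, (E.signers i d v t').card < f + 1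

/-- Step "Vote": at local time `t_prop + Δ - 0.5 d`, if it has not detected equivocation, party `i`
signs a vote for its first proposal with parameter `d`. -/
def CastsVote (i : Fin n) (d : ℝ) (v : V) (t : ℝ) : Prop :=
  d ∈ Icc 0 Δ ∧ (∃ tp, E.prop i = some (tp, v) ∧ t = tp + Δ - d / 2) ∧ ¬ E.Detects i t ∧
    E.Running Δ i t

/-- The honest party `i` sends `m` to all parties at time `t`. A proposal is sent in step "Propose"
by the broadcaster when it starts, or in step "Forward"; a vote is sent by the voter, or is one of
`f + 1` votes that are forwarded in step "Commit and Lock". -/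
def Sends (i : Fin n) (m : Msg n V) (t : ℝ) : Prop :=
  E.Running Δ i t ∧
    match m with
    | .propose v => (i = L ∧ v = E.input ∧ t = E.setting.start L) ∨ E.prop i = some (t, v)
    | .vote d v k => (k = i ∧ E.CastsVote Δ i d v t) ∨ (E.VotesAt Δ i d v t ∧ k ∈ E.fwd i d v)

/-- Step "Commit and Lock", part (a): `i` commits `v` at time `t`. -/
def EarlyCommits (i : Fin n) (v : V) (t : ℝ) : Prop :=
  ∃ d tv tp u, E.VotesAt Δ i d v tv ∧ E.prop i = some (tp, u) ∧ tv - tp ≤ Δ + 3 / 2 * d ∧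
    ¬ E.Detects i (tp + Δ + d / 2) ∧ t = max tv (tp + Δ + d / 2) ∧ E.DirectRcv Δ L i t ∧
    E.Running Δ i t

/-- Step "Commit and Lock", part (b): `f + 1` votes for `d`, `v`, received at time `tv`, meet the
time condition for an update of `lock` before `BA` is invoked. -/
def Lockable (i : Fin n) (d : ℝ) (v : V) (tv : ℝ) : Prop :=
  E.VotesAt Δ i d v tv ∧ tv ≤ E.setting.start i + baTime Δ ∧
    ∃ tp u, E.prop i = some (tp, u) ∧ tp ≤ E.setting.start i + baTime Δ ∧ tv - tp ≤ 9 / 2 * Δ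

/-- `lock` after all updates "if `rank > d`, set `lock = v` and `rank = d`", starting from
`lock = ⊥` and `rank = Δ + 1`: the value whose votes have the smallest `d` and, among those, came
first. As `d` ranges over an interval, a smallest `d` need not exist; then it is a value with
votes for arbitrarily small ones among the occurring `d`. Ties are broken arbitrarily. -/
def IsLock (i : Fin n) : Option V → Prop
  | none => ∀ d v tv, ¬ E.Lockable Δ i d v tv
  | some v => (∃ d tv, E.Lockable Δ i d v tv) ∧
      ∀ d' v' tv', E.Lockable Δ i d' v' tv' →
        ∃ d tv, E.Lockable Δ i d v tv ∧ (d < d' ∨ d = d' ∧ tv ≤ tv')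

/-- `i` commits `o` at time `t`: in step "Commit and Lock", or, if it has not committed, on the
output of `BA`. -/
def Commits (i : Fin n) (o : Option V) (t : ℝ) : Prop :=
  (∃ v, o = some v ∧ E.EarlyCommits Δ L i v t) ∨
    (E.BAOutputs Δ i o t ∧ ∀ v, ∀ t' ≤ t, ¬ E.EarlyCommits Δ L i v t')

/-- `E` is an execution of the protocol: honest parties follow it, messages between honest parties
have delay in `[0, δ]`, Byzantine parties are arbitrary, and signatures are unforgeable. -/
structure IsExecution : Prop where
  after_start : ∀ i ∈ E.setting.honest, ∀ j m r, E.rcv i j m = some r → E.setting.start i ≤ r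
  delivered : ∀ i ∈ E.setting.honest, ∀ j ∈ E.setting.honest, ∀ m t, E.Sends Δ L j m t →
    ∃ r, E.rcv i j m = some r ∧ r ≤ t + δ
  authentic : ∀ i ∈ E.setting.honest, ∀ j ∈ E.setting.honest, ∀ m r, E.rcv i j m = some r →
    ∃ t ≤ r, E.Sends Δ L j m t
  /-- an honest broadcaster signs only its input, when it starts -/
  unforgeable_proposal : L ∈ E.setting.honest → ∀ i ∈ E.setting.honest, ∀ j m r,
    E.rcv i j m = some r → m.value = E.input ∧ E.setting.start L ≤ r
  unforgeable_vote : ∀ i ∈ E.setting.honest, ∀ j d v r, ∀ k ∈ E.setting.honest,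
    E.rcv i j (.vote d v k) = some r → ∃ t ≤ r, E.CastsVote Δ k d v t
  prop_none : ∀ i ∈ E.setting.honest, E.prop i = none → ∀ j v, E.rcv i j (.propose v) = none
  prop_some : ∀ i ∈ E.setting.honest, ∀ t v, E.prop i = some (t, v) →
    (∃ j, E.rcv i j (.propose v) = some t) ∧
      ∀ j v' r, E.rcv i j (.propose v') = some r → t ≤ r
  fwd_spec : ∀ i ∈ E.setting.honest, ∀ d v t, E.VotesAt Δ i d v t →
    E.fwd i d v ⊆ E.signers i d v t ∧ (E.fwd i d v).card = f + 1
  lock_spec : ∀ i ∈ E.setting.honest, E.IsLock Δ i (E.lock i)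
  ba_execution : BA.IsExecution (E.setting.shift (baTime Δ)) E.lock E.baRcv

/-- The observable part of an execution. -/
def toRun : BroadcastRun n V where
  honest := E.setting.honest
  start := E.setting.start
  input := E.input
  commits := E.Commits Δ L
  terminates := E.Terminates Δ

end Trace

/-- The executions of the (Δ + 1.5δ)-BB protocol with broadcaster `L`, at most `f` Byzantine
parties, known delay bound `Δ`, and Byzantine agreement primitive `BA`, whose actual delay bound
is `δ`. -/
def runs {n : ℕ} {V : Type u} (BA : Protocol.{u, w} n (Option V) (Option V)) (f : ℕ) (Δ : ℝ)
    (L : Fin n) (δ : ℝ) : Set (BroadcastRun n V) :=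
  {R | ∃ E : Trace BA f δ, E.IsExecution Δ L ∧ R = E.toRun Δ L}

end DeltaBB

end

/-!
**The protocol.** Suppose that an honest party `i`, whose first proposal `u` arrives at time `t`,
detects no equivocation until `t + Δ + d / 2`. As proposals are forwarded, every honest party receives
values other than `u` only after `t + d / 2` (and `u` itself by `t + Δ`), so it detects equivocation
before it could vote for another value with a parameter `d' ≤ d`
(`DeltaBB.Trace.IsExecution.vote_eq_of_not_detects`). Hence, if a party commits early, the votes that
it forwards make all honest parties lock its value, and the Byzantine agreement confirms
this value (`lock_eq_of_earlyCommits`). With an honest broadcaster nobody detects equivocation, and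
the votes with `d = δ` arrive in time for a commit within `Δ + 3 / 2 * δ` (`exists_earlyCommits`).

**Optimality.** Besides the broadcaster there are two camps, one for each of two values, and a rest
of at most `f - 2` parties. A camp consists of a solo party and a crowd of `f - 1` parties; `n < 3 * f`
is what makes these sizes possible. In the good case of a camp, the broadcaster has the value of
this camp and the other camp is Byzantine and silent; everybody starts and receives the value a time
`δ` after the broadcaster, and the solo party commits by assumption before `Δ + 3 / 2 * δ`. In the
split case the broadcaster and the rest are Byzantine and show each camp the face of its good
case, while both crowds and one of the solo parties are honest. The two split cases, one for each
honest solo party, come from one and the same run of a network of nodes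
(`LowerBound.isExecution_splitSetting`): they differ by a shift of the clocks of one camp against
those of the other. If the camp without the honest solo party starts a time `h < δ / 2` after the
other one, messages from the former to the honest solo party take time `Δ`, and messages between
the crowds take `Δ` in one direction and `Δ - 2 * h` in the other. Then no trace of the second
value reaches the solo party before `δ + Δ + h` (`LowerBound.agreeBelow_solo`), so for `h` close to
`δ / 2` it commits as in its good case. The crowds, to which the two split cases look alike,
would have to agree with both solo parties.

Executions are obtained as fixed points (`Network.exists_step_eq`): as the delays of the network are
bounded below by a positive constant, what is received up to some time is determined by what was
received earlier. A party need not have a first time at which it sends a message, so the delay of a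
message counts from the infimum of these times; therefore delays in an execution have to be
positive, and `h` stays strictly below `δ / 2` to keep `Δ - 2 * h` positive if `δ = Δ`.
-/

/-! ### The protocol: agreement, validity, termination and latency -/

namespace DeltaBB

namespace Trace

variable {n : ℕ} {V : Type u} {BA : Protocol.{u, w} n (Option V) (Option V)} {f : ℕ} {δ : ℝ}
variable {E : Trace BA f δ} {Δ : ℝ} {L : Fin n}

theorem Running.mono {i : Fin n} {s t : ℝ} (h : E.Running Δ i t) (hst : s ≤ t) :
    E.Running Δ i s :=
  fun t' ht' => hst.trans (h t' ht')

/-- Nobody terminates before the invocation of the Byzantine agreement. -/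
theorem running_of_le_baTime {i : Fin n} {t : ℝ}
    (h : t ≤ E.setting.start i + baTime Δ) : E.Running Δ i t :=
  fun _ ht' => h.trans ht'.1.1.1

/-- Only finitely many votes for given `d`, `v` can arrive, so once `f + 1` signers are present
there was a first time at which they were. -/
theorem exists_votesAt {i : Fin n} {d : ℝ} {v : V} {t : ℝ} (hd : d ∈ Icc 0 Δ)
    (h : f + 1 ≤ (E.signers i d v t).card) : ∃ t₀ ≤ t, E.VotesAt Δ i d v t₀ := by
  have hfin : {r | ∃ j k, E.rcv i j (.vote d v k) = some r}.Finite := by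
    refine (Set.finite_range fun p : Fin n × Fin n =>
      (E.rcv i p.1 (.vote d v p.2)).getD 0).subset ?_
    rintro r ⟨j, k, hr⟩
    exact ⟨(j, k), by simp [hr]⟩
  -- Between two arrival times the set of signers is constant.
  have hlast : ∀ s, f + 1 ≤ (E.signers i d v s).card →
      ∃ r ∈ {r | ∃ j k, E.rcv i j (.vote d v k) = some r}, r ≤ s ∧
        f + 1 ≤ (E.signers i d v r).card := by
    intro s hs
    have hne : ({r | ∃ j k, E.rcv i j (.vote d v k) = some r} ∩ Iic s).Nonempty := by
      obtain ⟨k, hk⟩ := Finset.card_pos.1 (lt_of_lt_of_le (Nat.succ_pos f) hs)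
      simp only [signers, Finset.mem_filter, Finset.mem_univ, true_and] at hk
      obtain ⟨j, r, hr, hrs⟩ := hk
      exact ⟨r, ⟨j, k, hr⟩, hrs⟩
    obtain ⟨r, ⟨hr, hrs⟩, hmax⟩ :=
      Set.exists_max_image _ id (hfin.subset inter_subset_left) hne
    refine ⟨r, hr, hrs, hs.trans (Finset.card_le_card ?_)⟩
    intro k hk
    simp only [signers, Finset.mem_filter, Finset.mem_univ, true_and] at hk ⊢
    obtain ⟨j, r', hr', hrs'⟩ := hk
    exact ⟨j, r', hr', hmax r' ⟨⟨j, k, hr'⟩, hrs'⟩⟩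
  obtain ⟨r, hr, hrt, hrc⟩ := hlast t h
  obtain ⟨t₀, ⟨ht₀, ht₀c⟩, hmin⟩ := Set.exists_min_image
    ({r | ∃ j k, E.rcv i j (.vote d v k) = some r} ∩ {r | f + 1 ≤ (E.signers i d v r).card})
    id (hfin.subset inter_subset_left) ⟨r, hr, hrc⟩
  refine ⟨t₀, (hmin r ⟨hr, hrc⟩).trans hrt, hd, ht₀c, fun t' ht' => ?_⟩
  by_contra hcon
  obtain ⟨r', hr', hrt', hrc'⟩ := hlast t' (not_lt.1 hcon)
  exact absurd (hmin r' ⟨hr', hrc'⟩) (not_le.2 (lt_of_le_of_lt hrt' ht'))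

theorem card_honest_ge (E : Trace BA f δ) (hn : 2 * f + 1 ≤ n) :
    f + 1 ≤ E.setting.honest.card := by
  have := E.setting.card_honest
  omega

namespace IsExecution

variable (hE : E.IsExecution Δ L)
include hE

/-- Among `f + 1` voters there is an honest one. -/
theorem exists_castsVote {i : Fin n} (hi : i ∈ E.setting.honest) {d : ℝ} {v : V} {t : ℝ}
    (h : E.VotesAt Δ i d v t) : ∃ k ∈ E.setting.honest, ∃ t, E.CastsVote Δ k d v t := by
  have hex : ∃ k ∈ E.signers i d v t, k ∈ E.setting.honest := by
    by_contra! hcon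
    have hsub : E.signers i d v t ⊆ E.setting.honestᶜ := fun k hk => by
      simpa using hcon k hk
    have h1 := Finset.card_le_card hsub
    rw [Finset.card_compl, Fintype.card_fin] at h1
    have := E.setting.card_honest
    have := h.2.1
    omega
  obtain ⟨k, hk, hkh⟩ := hex
  simp only [signers, Finset.mem_filter, Finset.mem_univ, true_and] at hk
  obtain ⟨j, r, hr, -⟩ := hk
  obtain ⟨t, -, ht⟩ := hE.unforgeable_vote i hi j d v r k hkh hr
  exact ⟨k, hkh, t, ht⟩

/-- A proposal is forwarded by every honest party to which it is the first one. -/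
theorem exists_rcv_of_prop {i j : Fin n} (hi : i ∈ E.setting.honest) (hj : j ∈ E.setting.honest)
    {tp : ℝ} {v : V} (hp : E.prop j = some (tp, v)) (hrun : E.Running Δ j tp) :
    ∃ r, E.rcv i j (.propose v) = some r ∧ r ≤ tp + δ :=
  hE.delivered i hi j hj _ tp ⟨hrun, Or.inr hp⟩

theorem exists_prop_of_rcv {i : Fin n} (hi : i ∈ E.setting.honest) {j : Fin n} {v : V} {r : ℝ}
    (h : E.rcv i j (.propose v) = some r) : ∃ tp u, E.prop i = some (tp, u) ∧ tp ≤ r := by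
  rcases hp : E.prop i with _ | ⟨tp, u⟩
  · simp [hE.prop_none i hi hp j v] at h
  · exact ⟨tp, u, rfl, (hE.prop_some i hi tp u hp).2 j v r h⟩

/-- The reason for agreement. If `i` detects no equivocation until `Δ + d / 2` after its first
proposal `u`, then every honest party receives other values later than `d / 2` after that proposal,
and `u` itself within `Δ` after it; hence it detects equivocation before a vote for another
value with a parameter `d' ≤ d` is due. -/
theorem vote_eq_of_not_detects (hδ : δ ≤ Δ) {i k : Fin n} (hi : i ∈ E.setting.honest)
    (hk : k ∈ E.setting.honest) {tp d d' t : ℝ} {u v : V} (hp : E.prop i = some (tp, u))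
    (hd : 0 ≤ d) (hdet : ¬ E.Detects i (tp + Δ + d / 2))
    (hrun : E.Running Δ i tp) (hv : E.CastsVote Δ k d' v t) (hdd : d' ≤ d) : v = u := by
  obtain ⟨⟨hd0, hd1⟩, ⟨tk, hpk, rfl⟩, hdetk, hrunk⟩ := hv
  by_contra hne
  obtain ⟨j, hj⟩ := (hE.prop_some i hi tp u hp).1
  obtain ⟨j', hj'⟩ := (hE.prop_some k hk tk v hpk).1
  obtain ⟨r, hr, hrt⟩ := hE.exists_rcv_of_prop hi hk hpk (hrunk.mono (by linarith))
  obtain ⟨r', hr', hrt'⟩ := hE.exists_rcv_of_prop hk hi hp hrun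
  have hlate : tp + Δ + d / 2 < r := by
    by_contra! hcon
    exact hdet ⟨j, _, tp, k, _, r, hj, by linarith, hr, hcon, fun h => hne h.symm⟩
  exact hdetk ⟨j', _, tk, i, _, r', hj', by linarith, hr', by linarith, hne⟩

/-- An early commit fixes `lock`, the input to the Byzantine agreement, at all honest parties: the
forwarded votes reach them in time, and no other value gets votes with the same or a smaller
parameter. -/
theorem lock_eq_of_earlyCommits (hδ : δ ∈ Icc 0 Δ) {i j : Fin n} (hi : i ∈ E.setting.honest)
    (hj : j ∈ E.setting.honest) {v : V} {t : ℝ} (h : E.EarlyCommits Δ L i v t) :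
    E.lock j = some v := by
  obtain ⟨d, tv, tp, u, hvotes, hp, htv, hdet, rfl, ⟨v', r, hr, -, hrt⟩, hrun⟩ := h
  obtain ⟨hδ0, hδ1⟩ := hδ
  have hd := hvotes.1
  obtain ⟨hd0, hd1⟩ := id hd
  have hruntp : E.Running Δ i tp := hrun.mono (le_trans (by linarith) (le_max_right _ _))
  have hkey : ∀ l ∈ E.setting.honest, ∀ d' w s, E.VotesAt Δ l d' w s → d' ≤ d → w = u := by
    intro l hl d' w s hw hdd
    obtain ⟨k, hk, s', hs'⟩ := hE.exists_castsVote hl hw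
    exact hE.vote_eq_of_not_detects hδ1 hi hk hp hd0 hdet hruntp hs' hdd
  obtain rfl : v = u := hkey i hi d v tv hvotes le_rfl
  have htp : tp ≤ E.setting.start i + 2 * Δ := by
    have := (hE.prop_some i hi tp v hp).2 L v' r hr
    rw [sigma] at hrt
    linarith
  have hskew := abs_le.1 (E.setting.skew i hi j hj)
  have hba : baTime Δ = 17 / 2 * Δ := by rw [baTime, sigma]; ring
  have hlockable : ∃ tv', E.Lockable Δ j d v tv' := by
    obtain ⟨hsub, hcard⟩ := hE.fwd_spec i hi d v tv hvotes
    obtain ⟨tv', htv', hvotes'⟩ : ∃ t₀ ≤ tv + δ, E.VotesAt Δ j d v t₀ := by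
      refine exists_votesAt hd (hcard.ge.trans (Finset.card_le_card fun k hk => ?_))
      obtain ⟨r', hr', hrt'⟩ := hE.delivered j hj i hi (.vote d v k) tv
        ⟨hrun.mono (le_max_left _ _), Or.inr ⟨hvotes, hk⟩⟩
      simp only [signers, Finset.mem_filter, Finset.mem_univ, true_and]
      exact ⟨i, r', hr', hrt'⟩
    obtain ⟨r', hr', hrt'⟩ := hE.exists_rcv_of_prop hj hi hp hruntp
    obtain ⟨tj, uj, hpj, htj⟩ := hE.exists_prop_of_rcv hj hr'
    obtain ⟨r'', hr'', hrt''⟩ := hE.exists_rcv_of_prop hi hj hpj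
      (running_of_le_baTime (by linarith))
    have := (hE.prop_some i hi tp v hp).2 j uj r'' hr''
    exact ⟨tv', hvotes', by linarith, tj, uj, hpj, by linarith, by linarith⟩
  obtain ⟨tv', htv'⟩ := hlockable
  have hlock := hE.lock_spec j hj
  rcases hl : E.lock j with _ | w
  · rw [hl] at hlock
    exact absurd htv' (hlock d v tv')
  · rw [hl] at hlock
    obtain ⟨d', s, hs, hlt⟩ := hlock.2 d v tv' htv'
    rw [hkey j hj d' w s hs.1 (hlt.elim le_of_lt fun h => h.1.le)]

/-- With an honest broadcaster, the votes with parameter `d = δ` let every honest party commit. -/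
theorem exists_earlyCommits (hδ : δ ∈ Icc 0 Δ) (hn : 2 * f + 1 ≤ n) (hL : L ∈ E.setting.honest)
    {i : Fin n} (hi : i ∈ E.setting.honest) :
    ∃ t ≤ E.setting.start L + (Δ + 3 / 2 * δ), E.EarlyCommits Δ L i E.input t := by
  obtain ⟨hδ0, hδ1⟩ := id hδ
  have hba : baTime Δ = 17 / 2 * Δ := by rw [baTime, sigma]; ring
  have hdet : ∀ j ∈ E.setting.honest, ∀ t, ¬ E.Detects j t := by
    rintro j hj t ⟨a, m, r, a', m', r', hm, -, hm', -, hne⟩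
    exact hne ((hE.unforgeable_proposal hL j hj a m r hm).1.trans
      (hE.unforgeable_proposal hL j hj a' m' r' hm').1.symm)
  have hdirect : ∀ j ∈ E.setting.honest,
      ∃ r, E.rcv j L (.propose E.input) = some r ∧ r ≤ E.setting.start L + δ := fun j hj =>
    hE.delivered j hj L hL _ _
      ⟨running_of_le_baTime (by linarith), Or.inl ⟨rfl, rfl, rfl⟩⟩
  have hprop : ∀ j ∈ E.setting.honest, ∃ tp, E.prop j = some (tp, E.input) ∧
      E.setting.start L ≤ tp ∧ tp ≤ E.setting.start L + δ := by
    intro j hj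
    obtain ⟨r, hr, hrt⟩ := hdirect j hj
    obtain ⟨tp, u, hp, htp⟩ := hE.exists_prop_of_rcv hj hr
    obtain ⟨a, ha⟩ := (hE.prop_some j hj tp u hp).1
    obtain ⟨hu, hs⟩ := hE.unforgeable_proposal hL j hj a _ tp ha
    obtain rfl : u = E.input := hu
    exact ⟨tp, hp, hs, htp.trans hrt⟩
  obtain ⟨tv, htv, hvotes⟩ : ∃ t₀ ≤ E.setting.start L + (Δ + 3 / 2 * δ),
      E.VotesAt Δ i δ E.input t₀ := by
    refine exists_votesAt hδ ((E.card_honest_ge hn).trans (Finset.card_le_card fun k hk => ?_))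
    obtain ⟨tp, hp, h1, h2⟩ := hprop k hk
    have hskew := abs_le.1 (E.setting.skew L hL k hk)
    have hrun : E.Running Δ k (tp + Δ - δ / 2) := running_of_le_baTime (by linarith)
    obtain ⟨r, hr, hrt⟩ := hE.delivered i hi k hk (.vote δ E.input k) (tp + Δ - δ / 2)
      ⟨hrun, Or.inl ⟨rfl, hδ, ⟨tp, hp, rfl⟩, hdet k hk _, hrun⟩⟩
    simp only [signers, Finset.mem_filter, Finset.mem_univ, true_and]
    exact ⟨k, r, hr, by linarith⟩
  obtain ⟨tp, hp, h1, h2⟩ := hprop i hi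
  obtain ⟨r, hr, hrt⟩ := hdirect i hi
  have hskew := abs_le.1 (E.setting.skew L hL i hi)
  have hle : max tv (tp + Δ + δ / 2) ≤ E.setting.start L + (Δ + 3 / 2 * δ) :=
    max_le htv (by linarith)
  refine ⟨_, hle, δ, tv, tp, E.input, hvotes, hp, by linarith, hdet i hi _, rfl,
    ⟨E.input, r, hr, le_trans (by linarith) (le_max_right _ _), ?_⟩,
    running_of_le_baTime (by linarith)⟩
  rw [sigma]
  linarith

end IsExecution

end Trace

/-- The (Δ + 1.5δ)-BB protocol solves Byzantine broadcast. -/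
theorem solvesByzantineBroadcast {n f : ℕ} {V : Type u} {Δ : ℝ} (hn : 2 * f + 1 ≤ n) (L : Fin n)
    (BA : Protocol.{u, w} n (Option V) (Option V)) (hBA : BA.SolvesByzantineAgreement f Δ) :
    SolvesByzantineBroadcast L Δ (runs BA f Δ L) := by
  rintro δ hδ _ ⟨E, hE, rfl⟩
  obtain ⟨hagree, hvalid, hterm⟩ := hBA δ hδ _ _ _ hE.ba_execution
  have hBAout : ∀ i ∈ E.setting.honest, ∀ v t, E.EarlyCommits Δ L i v t →
      ∀ j ∈ E.setting.honest, ∀ o t', E.BAOutputs Δ j o t' → o = some v := by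
    intro i hi v t h j hj o t' ho
    obtain ⟨s, hs⟩ := hvalid (some v) (fun k hk => hE.lock_eq_of_earlyCommits hδ hi hk h) j hj
    exact hagree j hj j hj _ _ _ _ ho hs
  have hterminates : ∀ i ∈ E.setting.honest, ∃ t, E.Terminates Δ i t := by
    intro i hi
    obtain ⟨⟨o, t, ho⟩, t', ht'⟩ := hterm i hi
    refine ⟨t', ht', o, t, ?_, ho⟩
    by_contra! hlt
    exact ho.1.2 t' ht'.1.1 hlt ht'.2
  refine ⟨?_, ?_, ?_⟩
  · rintro i hi j hj o o' t t' (⟨v, rfl, hv⟩ | ⟨ho, -⟩) (⟨v', rfl, hv'⟩ | ⟨ho', -⟩)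
    · rw [← hE.lock_eq_of_earlyCommits hδ hi hi hv, ← hE.lock_eq_of_earlyCommits hδ hj hi hv']
    · exact (hBAout i hi v t hv j hj o' t' ho').symm
    · exact hBAout j hj v' t' hv' i hi o t ho
    · exact hagree i hi j hj _ _ _ _ ho ho'
  · intro hL i hi
    obtain ⟨t, -, ht⟩ := hE.exists_earlyCommits hδ hn hL hi
    exact ⟨⟨t, Or.inl ⟨_, rfl, ht⟩⟩, hterminates i hi⟩
  · intro i hi
    refine ⟨?_, hterminates i hi⟩
    obtain ⟨⟨o, t, ho⟩, -⟩ := hterm i hi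
    by_cases h : ∃ v, ∃ t' ≤ t, E.EarlyCommits Δ L i v t'
    · obtain ⟨v, t', -, hv⟩ := h
      exact ⟨some v, t', Or.inl ⟨v, rfl, hv⟩⟩
    · push Not at h
      exact ⟨o, t, Or.inr ⟨ho, h⟩⟩

theorem hasGoodCaseLatency {n f : ℕ} {V : Type u} {Δ : ℝ} (hn : 2 * f + 1 ≤ n) (L : Fin n)
    (BA : Protocol.{u, w} n (Option V) (Option V)) :
    HasGoodCaseLatency L Δ (runs BA f Δ L) (fun δ => Δ + 3 / 2 * δ) := by
  rintro δ hδ _ ⟨E, hE, rfl⟩ hL i hi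
  obtain ⟨t, hle, ht⟩ := hE.exists_earlyCommits hδ hn hL hi
  exact ⟨_, t, Or.inl ⟨_, rfl, ht⟩, hle⟩

end DeltaBB

noncomputable section

/-! ### The local view of a single party -/

namespace Protocol

variable {n : ℕ} {I O : Type u} (P : Protocol.{u, w} n I O)

/-- The history of a party that starts at time `s` and receives `m` from `j` at time `r` if
`ρ j m = some r`, up to time `t`. -/
def localView (s : ℝ) (ρ : Fin n → P.Msg → Option ℝ) (t : ℝ) : History n P.Msg :=
  {e | ∃ r, ρ e.2.1 e.2.2 = some r ∧ r ≤ t ∧ e.1 = r - s}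

/-- `Protocol.Active` in terms of the start time and the receipts of the party alone. -/
def LocalActive (i : Fin n) (a : I) (s : ℝ) (ρ : Fin n → P.Msg → Option ℝ) (t : ℝ) : Prop :=
  s ≤ t ∧ ∀ t', s ≤ t' → t' < t → ¬ P.halt i a (P.localView s ρ t') (t' - s)

/-- `Protocol.Commits` in terms of the start time and the receipts of the party alone. -/
def LocalCommits (i : Fin n) (a : I) (s : ℝ) (ρ : Fin n → P.Msg → Option ℝ) (o : O) (t : ℝ) :
    Prop :=
  P.LocalActive i a s ρ t ∧ P.output i a (P.localView s ρ t) (t - s) = some o ∧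
    ∀ t', s ≤ t' → t' < t → P.output i a (P.localView s ρ t') (t' - s) = none

/-- `Protocol.Sends` in terms of the start time and the receipts of the party alone. -/
def LocalSends (i : Fin n) (a : I) (s : ℝ) (ρ : Fin n → P.Msg → Option ℝ) (j : Fin n) (m : P.Msg)
    (t : ℝ) : Prop :=
  P.LocalActive i a s ρ t ∧ (j, m) ∈ P.send i a (P.localView s ρ t) (t - s)

theorem commits_iff_localCommits {f : ℕ} {δ : ℝ} (S : Setting n f δ) (x : Fin n → I)
    (rcv : Fin n → Fin n → P.Msg → Option ℝ) (i : Fin n) (o : O) (t : ℝ) :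
    P.Commits S x rcv i o t ↔ P.LocalCommits i (x i) (S.start i) (rcv i) o t :=
  Iff.rfl

theorem sends_iff_localSends {f : ℕ} {δ : ℝ} (S : Setting n f δ) (x : Fin n → I)
    (rcv : Fin n → Fin n → P.Msg → Option ℝ) (i j : Fin n) (m : P.Msg) (t : ℝ) :
    P.Sends S x rcv i j m t ↔ P.LocalSends i (x i) (S.start i) (rcv i) j m t :=
  Iff.rfl

variable {P}

theorem LocalCommits.unique {i : Fin n} {a : I} {s : ℝ} {ρ : Fin n → P.Msg → Option ℝ} {o o' : O}
    {t t' : ℝ} (h : P.LocalCommits i a s ρ o t) (h' : P.LocalCommits i a s ρ o' t') : o = o' := by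
  rcases lt_trichotomy t t' with hlt | rfl | hlt
  · have := h'.2.2 t h.1.1 hlt
    rw [h.2.1] at this
    cases this
  · exact Option.some.inj (h.2.1.symm.trans h'.2.1)
  · have := h.2.2 t' h'.1.1 hlt
    rw [h'.2.1] at this
    cases this

/-- Receipts when the global clock is set forward by `c`. -/
def shiftReceipts (c : ℝ) (ρ : Fin n → P.Msg → Option ℝ) : Fin n → P.Msg → Option ℝ :=
  fun j m => (ρ j m).map (· + c)

theorem localView_shift (s c : ℝ) (ρ : Fin n → P.Msg → Option ℝ) (t : ℝ) :
    P.localView (s + c) (shiftReceipts c ρ) t = P.localView s ρ (t - c) := by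
  ext e
  simp only [localView, shiftReceipts, Option.map_eq_some_iff, mem_ofPred_eq]
  constructor
  · rintro ⟨_, ⟨r, hr, rfl⟩, hle, he⟩
    exact ⟨r, hr, by linarith, by linarith⟩
  · rintro ⟨r, hr, hle, he⟩
    exact ⟨r + c, ⟨r, hr, rfl⟩, by linarith, by linarith⟩

theorem forall_lt_shift_iff (s c t : ℝ) (p : ℝ → Prop) :
    (∀ t', s + c ≤ t' → t' < t → p (t' - c)) ↔ ∀ t', s ≤ t' → t' < t - c → p t' := by
  constructor
  · intro h t' h1 h2
    simpa using h (t' + c) (by linarith) (by linarith)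
  · exact fun h t' h1 h2 => h (t' - c) (by linarith) (by linarith)

theorem localActive_shift (i : Fin n) (a : I) (s c : ℝ) (ρ : Fin n → P.Msg → Option ℝ) (t : ℝ) :
    P.LocalActive i a (s + c) (shiftReceipts c ρ) t ↔ P.LocalActive i a s ρ (t - c) := by
  simp only [LocalActive, localView_shift, ← forall_lt_shift_iff s c t, ← sub_sub, le_sub_iff_add_le,
    sub_right_comm _ s c]

theorem localCommits_shift (i : Fin n) (a : I) (s c : ℝ) (ρ : Fin n → P.Msg → Option ℝ) (o : O)
    (t : ℝ) :
    P.LocalCommits i a (s + c) (shiftReceipts c ρ) o t ↔ P.LocalCommits i a s ρ o (t - c) := by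
  simp only [LocalCommits, localActive_shift, localView_shift, ← forall_lt_shift_iff s c t,
    ← sub_sub, sub_right_comm _ s c]

theorem localSends_shift (i : Fin n) (a : I) (s c : ℝ) (ρ : Fin n → P.Msg → Option ℝ) (j : Fin n)
    (m : P.Msg) (t : ℝ) :
    P.LocalSends i a (s + c) (shiftReceipts c ρ) j m t ↔ P.LocalSends i a s ρ j m (t - c) := by
  simp only [LocalSends, localActive_shift, localView_shift, ← sub_sub, sub_right_comm _ s c]

/-- The receipts `ρ` and `ρ'` are the same before time `θ`. -/
def AgreeBelow (ρ ρ' : Fin n → P.Msg → Option ℝ) (θ : ℝ) : Prop :=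
  ∀ j m r, r < θ → (ρ j m = some r ↔ ρ' j m = some r)

section AgreeBelow

variable {ρ ρ' ρ'' : Fin n → P.Msg → Option ℝ} {θ θ' t : ℝ}

theorem AgreeBelow.symm (h : AgreeBelow ρ ρ' θ) : AgreeBelow ρ' ρ θ :=
  fun j m r hr => (h j m r hr).symm

theorem AgreeBelow.trans (h : AgreeBelow ρ ρ' θ) (h' : AgreeBelow ρ' ρ'' θ) :
    AgreeBelow ρ ρ'' θ :=
  fun j m r hr => (h j m r hr).trans (h' j m r hr)

theorem AgreeBelow.mono (h : AgreeBelow ρ ρ' θ) (hle : θ' ≤ θ) : AgreeBelow ρ ρ' θ' :=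
  fun j m r hr => h j m r (hr.trans_le hle)

theorem AgreeBelow.localView_eq (h : AgreeBelow ρ ρ' θ) (ht : t < θ) (s : ℝ) :
    P.localView s ρ t = P.localView s ρ' t := by
  ext e
  refine exists_congr fun r => ?_
  constructor
  · rintro ⟨h1, h2, h3⟩
    exact ⟨(h _ _ r (h2.trans_lt ht)).1 h1, h2, h3⟩
  · rintro ⟨h1, h2, h3⟩
    exact ⟨(h _ _ r (h2.trans_lt ht)).2 h1, h2, h3⟩

theorem AgreeBelow.localActive (h : AgreeBelow ρ ρ' θ) (ht : t < θ) {i : Fin n} {a : I} {s : ℝ}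
    (hA : P.LocalActive i a s ρ t) : P.LocalActive i a s ρ' t :=
  ⟨hA.1, fun t' h1 h2 => by rw [← h.localView_eq (h2.trans ht) s]; exact hA.2 t' h1 h2⟩

theorem AgreeBelow.localCommits (h : AgreeBelow ρ ρ' θ) (ht : t < θ) {i : Fin n} {a : I} {s : ℝ}
    {o : O} (hA : P.LocalCommits i a s ρ o t) : P.LocalCommits i a s ρ' o t :=
  ⟨h.localActive ht hA.1, by rw [← h.localView_eq ht s]; exact hA.2.1,
    fun t' h1 h2 => by rw [← h.localView_eq (h2.trans ht) s]; exact hA.2.2 t' h1 h2⟩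

theorem AgreeBelow.localSends (h : AgreeBelow ρ ρ' θ) (ht : t < θ) {i : Fin n} {a : I} {s : ℝ}
    {j : Fin n} {m : P.Msg} (hA : P.LocalSends i a s ρ j m t) : P.LocalSends i a s ρ' j m t :=
  ⟨h.localActive ht hA.1, by rw [← h.localView_eq ht s]; exact hA.2⟩

end AgreeBelow

end Protocol

/-! ### Networks in which every node runs the protocol -/

theorem csInf_eq_of_inter_Iio_eq {A B : Set ℝ} {θ : ℝ} (hA : A.Nonempty) (hbA : BddBelow A)
    (hbB : BddBelow B) (hθ : sInf A < θ) (h : ∀ t < θ, t ∈ A ↔ t ∈ B) :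
    B.Nonempty ∧ sInf B = sInf A := by
  obtain ⟨t, ht, htθ⟩ := exists_lt_of_csInf_lt hA hθ
  have hB : B.Nonempty := ⟨t, (h t htθ).1 ht⟩
  refine ⟨hB, le_antisymm ?_ ?_⟩
  · refine le_of_forall_gt fun y hy => ?_
    obtain ⟨t, ht, hty⟩ := exists_lt_of_csInf_lt hA (lt_min hy hθ)
    exact (csInf_le hbB ((h t (hty.trans_le (min_le_right _ _))).1 ht)).trans_lt
      (hty.trans_le (min_le_left _ _))
  · refine le_of_forall_gt fun y hy => ?_
    by_cases hlt : sInf B < θ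
    · obtain ⟨t, ht, hty⟩ := exists_lt_of_csInf_lt hB (lt_min hy hlt)
      exact (csInf_le hbA ((h t (hty.trans_le (min_le_right _ _))).2 ht)).trans_lt
        (hty.trans_le (min_le_left _ _))
    · exact hθ.trans (lt_of_le_of_lt (not_lt.1 hlt) hy)

/-- A network whose nodes `N` all follow the protocol; a node runs the code of its `party`, and
several nodes may run the code of the same party. The node `src u j` plays the role of party `j`
towards `u`; its messages reach `u` after `delay u j`. Times are those of one reference clock. -/
structure Network (n : ℕ) (I : Type u) (N : Type) where
  party : N → Fin n
  start : N → ℝ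
  input : N → I
  src : N → Fin n → N
  delay : N → Fin n → ℝ
  party_src : ∀ u j, party (src u j) = j
  start_nonneg : ∀ u, 0 ≤ start u

namespace Network

variable {n : ℕ} {I O : Type u} {N : Type} (W : Network n I N) (P : Protocol.{u, w} n I O)

/-- The times at which party `j` of node `u` sends `m` to `u`, if the nodes receive `R`. -/
def sendTimes (R : N → Fin n → P.Msg → Option ℝ) (u : N) (j : Fin n) (m : P.Msg) : Set ℝ :=
  {t | P.LocalSends j (W.input (W.src u j)) (W.start (W.src u j)) (R (W.src u j)) (W.party u) m t}

open Classical in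
/-- The receipts caused by the messages that are sent when the nodes receive `R`; only the links in
`lk` work. The send times of a message need not have a minimum, so the delay counts from their
infimum. -/
def step (lk : N → Fin n → Prop) (R : N → Fin n → P.Msg → Option ℝ) :
    N → Fin n → P.Msg → Option ℝ := fun u j m =>
  if lk u j ∧ (W.sendTimes P R u j m).Nonempty then
    some (sInf (W.sendTimes P R u j m) + W.delay u j)
  else none

variable {W P} {lk lk' : N → Fin n → Prop} {R R' : N → Fin n → P.Msg → Option ℝ} {u : N}
  {j : Fin n} {m : P.Msg} {r η : ℝ}

theorem step_eq_some : W.step P lk R u j m = some r ↔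
    lk u j ∧ (W.sendTimes P R u j m).Nonempty ∧
      sInf (W.sendTimes P R u j m) + W.delay u j = r := by
  unfold step
  split_ifs with h
  · simp [h]
  · simp only [false_iff]
    exact fun h' => h ⟨h'.1, h'.2.1⟩

theorem start_mem_lowerBounds : W.start (W.src u j) ∈ lowerBounds (W.sendTimes P R u j m) :=
  fun _ ht => ht.1.1

theorem bddBelow_sendTimes : BddBelow (W.sendTimes P R u j m) :=
  ⟨_, start_mem_lowerBounds⟩

theorem start_add_delay_le_of_step (h : W.step P lk R u j m = some r) :
    W.start (W.src u j) + W.delay u j ≤ r := by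
  obtain ⟨-, hne, rfl⟩ := step_eq_some.1 h
  have := le_csInf hne start_mem_lowerBounds
  linarith

theorem step_mono_of_agreeBelow {θ : ℝ}
    (h : Protocol.AgreeBelow (R (W.src u j)) (R' (W.src u j)) θ) (hlk : lk u j → lk' u j)
    (hr : r < θ + W.delay u j) (hs : W.step P lk R u j m = some r) :
    W.step P lk' R' u j m = some r := by
  obtain ⟨hl, hne, rfl⟩ := step_eq_some.1 hs
  obtain ⟨h1, h2⟩ := csInf_eq_of_inter_Iio_eq (θ := θ) hne bddBelow_sendTimes
    (B := W.sendTimes P R' u j m) bddBelow_sendTimes (by linarith)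
    fun t ht => ⟨h.localSends ht, h.symm.localSends ht⟩
  exact step_eq_some.2 ⟨hlk hl, h1, by rw [h2]⟩

/-- Receipts before `θ + delay` are determined by the receipts of the sender before `θ`. -/
theorem step_iff_of_agreeBelow {θ : ℝ}
    (h : Protocol.AgreeBelow (R (W.src u j)) (R' (W.src u j)) θ) (hlk : lk u j ↔ lk' u j)
    (hr : r < θ + W.delay u j) :
    W.step P lk R u j m = some r ↔ W.step P lk' R' u j m = some r :=
  ⟨step_mono_of_agreeBelow h hlk.1 hr, step_mono_of_agreeBelow h.symm hlk.2 hr⟩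

theorem agreeBelow_iterate_succ (hη : ∀ u j, η ≤ W.delay u j) (h0 : 0 < η) (k : ℕ) (u : N) :
    Protocol.AgreeBelow (((W.step P lk)^[k] fun _ _ _ => none) u)
      (((W.step P lk)^[k + 1] fun _ _ _ => none) u) (k * η) := by
  induction k generalizing u with
  | zero =>
    intro j m r hr
    simp only [Function.iterate_zero, id_eq, reduceCtorEq, zero_add, Function.iterate_one,
      false_iff]
    intro h
    have h1 := start_add_delay_le_of_step h
    have h2 := W.start_nonneg (W.src u j)
    have h3 := hη u j
    simp at hr
    linarith
  | succ k ih =>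
    intro j m r hr
    rw [Function.iterate_succ_apply', Function.iterate_succ_apply' _ (k + 1)]
    refine step_iff_of_agreeBelow (ih _) Iff.rfl ?_
    have := hη u j
    push_cast at hr
    linarith

/-- As all delays are positive, the network has a run: receipts that are caused by the messages
sent on them. -/
theorem exists_step_eq (hη : ∀ u j, η ≤ W.delay u j) (h0 : 0 < η) (lk : N → Fin n → Prop) :
    ∃ R : N → Fin n → P.Msg → Option ℝ, W.step P lk R = R := by
  classical
  set A : ℕ → N → Fin n → P.Msg → Option ℝ := fun k => (W.step P lk)^[k] fun _ _ _ => none with hA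
  have hstable : ∀ k l, k ≤ l → ∀ u, Protocol.AgreeBelow (A k u) (A l u) (k * η) := by
    intro k l hkl
    induction l, hkl using Nat.le_induction with
    | base => exact fun u j m r _ => Iff.rfl
    | succ l hkl ih =>
      intro u
      refine (ih u).trans ((agreeBelow_iterate_succ hη h0 l u).mono ?_)
      have : (k : ℝ) ≤ l := by exact_mod_cast hkl
      exact mul_le_mul_of_nonneg_right this h0.le
  let R : N → Fin n → P.Msg → Option ℝ := fun u j m =>
    if h : ∃ r, ∃ k : ℕ, r < k * η ∧ A k u j m = some r then some h.choose else none
  have hR : ∀ k u, Protocol.AgreeBelow (A k u) (R u) (k * η) := by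
    intro k u j m r hr
    have hiff : ∀ r', R u j m = some r' → ∀ l : ℕ, r' < l * η → A l u j m = some r' := by
      intro r' hr' l hl
      simp only [R] at hr'
      split_ifs at hr' with h
      obtain ⟨k', hk', hAk'⟩ := h.choose_spec
      rw [Option.some.inj hr'] at hk' hAk'
      rcases le_total k' l with hle | hle
      · exact (hstable k' l hle u j m r' hk').1 hAk'
      · exact (hstable l k' hle u j m r' hl).2 hAk'
    refine ⟨fun h => ?_, fun h => hiff r h k hr⟩
    have hex : ∃ r, ∃ k : ℕ, r < k * η ∧ A k u j m = some r := ⟨r, k, hr, h⟩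
    have hRu : R u j m = some hex.choose := dif_pos hex
    obtain ⟨k', hk', hAk'⟩ := hex.choose_spec
    rw [hRu]
    rcases le_total k' k with hle | hle
    · rw [← (hstable k' k hle u j m _ hk').1 hAk', h]
    · rw [← hAk', (hstable k k' hle u j m r hr).1 h]
  refine ⟨R, ?_⟩
  funext u j m
  refine Option.ext fun r => ?_
  obtain ⟨k, hk⟩ := exists_nat_gt (r / η)
  have hk' : r < k * η := (div_lt_iff₀ h0).1 hk
  have hk1 : r < (k + 1 : ℕ) * η := by push_cast; linarith
  rw [← hR (k + 1) u j m r hk1]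
  simp only [hA, Function.iterate_succ_apply']
  exact step_iff_of_agreeBelow (hR k _).symm Iff.rfl (by linarith [hη u j])

/-- Two runs with different links `lk`, `lk'` agree at `u` below `θ u`, for all nodes `u` in a region
`G`, if the links that are in one of them only cannot be felt at `u` before `θ u`: no such link
brings a message before `θ u`, and the common links propagate the difference slowly enough. -/
theorem agreeBelow_of_links (hη : ∀ u j, η ≤ W.delay u j) (h0 : 0 < η)
    (hR : W.step P lk R = R) (hR' : W.step P lk' R' = R') {G : N → Prop} {θ : N → ℝ}
    (h : ∀ u j, G u →
      ((lk u j ↔ lk' u j) ∧ G (W.src u j) ∧ θ u ≤ θ (W.src u j) + W.delay u j) ∨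
      (¬ lk u j ∧ (lk' u j → θ u ≤ W.start (W.src u j) + W.delay u j)))
    (u : N) (hu : G u) : Protocol.AgreeBelow (R u) (R' u) (θ u) := by
  have key : ∀ k : ℕ, ∀ u, G u → Protocol.AgreeBelow (R u) (R' u) (min (θ u) (k * η)) := by
    intro k
    induction k with
    | zero =>
      intro u _ j m r hr
      have hr0 : r < 0 := by
        have := hr.trans_le (min_le_right _ _)
        simpa using this
      have hpos := add_nonneg (W.start_nonneg (W.src u j)) (h0.le.trans (hη u j))
      constructor
      · intro hs
        rw [← hR] at hs
        linarith [start_add_delay_le_of_step hs]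
      · intro hs
        rw [← hR'] at hs
        linarith [start_add_delay_le_of_step hs]
    | succ k ih =>
      intro u hu j m r hr
      obtain ⟨hr1, hr2⟩ := lt_min_iff.1 hr
      rcases h u j hu with ⟨hlk, hG, hθ⟩ | ⟨hlk, hθ⟩
      · rw [← hR, ← hR']
        refine step_iff_of_agreeBelow (ih _ hG) hlk ?_
        rw [← sub_lt_iff_lt_add, lt_min_iff]
        push_cast at hr2
        constructor <;> linarith [hη u j]
      · constructor
        · intro hs
          rw [← hR] at hs
          exact absurd (step_eq_some.1 hs).1 hlk
        · intro hs
          rw [← hR'] at hs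
          linarith [start_add_delay_le_of_step hs, hθ (step_eq_some.1 hs).1]
  intro j m r hr
  obtain ⟨k, hk⟩ := exists_nat_gt (r / η)
  exact key k u hu j m r (lt_min hr ((div_lt_iff₀ h0).1 hk))

/-- A signature of an honest party `p` that occurs in a message of the network stems from a message
that `p` itself has sent no later. Clocks are those of an execution in which the clock of node `u`
is shifted by `c u`. -/
theorem exists_sent_of_mem_sigs (hR : W.step P lk R = R) (h0 : 0 < η) {c : N → ℝ}
    {H : Finset (Fin n)} {ν : Fin n → N} {G : N → Prop} (hc : ∀ u, 0 ≤ c u)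
    (hGsrc : ∀ u j, G u → lk u j → G (W.src u j))
    (hGν : ∀ u, G u → W.party u ∈ H → u = ν (W.party u))
    (hpos : ∀ u j, G u → lk u j → η ≤ W.delay u j + c u - c (W.src u j))
    {t : ℝ} (hu : G u)
    (hs : P.LocalSends (W.party u) (W.input u) (W.start u) (R u) j m t)
    {p : Fin n} (hp : p ∈ H) {s : P.Stmt} (hm : (p, s) ∈ P.sigs m) :
    ∃ j' m' t', t' + c (ν p) ≤ t + c u ∧
      P.LocalSends p (W.input (ν p)) (W.start (ν p)) (R (ν p)) j' m' t' ∧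
        (p, s) ∈ P.sigs m' := by
  have key : ∀ k : ℕ, ∀ u j m t, G u → t + c u < k * (η / 2) →
      P.LocalSends (W.party u) (W.input u) (W.start u) (R u) j m t → (p, s) ∈ P.sigs m →
      ∃ j' m' t', t' + c (ν p) ≤ t + c u ∧
        P.LocalSends p (W.input (ν p)) (W.start (ν p)) (R (ν p)) j' m' t' ∧
          (p, s) ∈ P.sigs m' := by
    intro k
    induction k with
    | zero =>
      intro u j m t _ ht hs _
      have := W.start_nonneg u
      have := hs.1.1
      have := hc u
      simp at ht
      linarith
    | succ k ih =>
      intro u j m t hu ht hs hm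
      rcases P.no_forgery _ _ _ _ _ _ hs.2 p s hm with rfl | ⟨τ, j', m', ⟨r, hr, hrt, -⟩, hm'⟩
      · have huν := hGν u hu hp
        rw [← huν]
        exact ⟨j, m, t, le_rfl, hs, hm⟩
      · simp only at hr hrt
        rw [← hR] at hr
        obtain ⟨hl, hne, hr⟩ := step_eq_some.1 hr
        have hp' := hpos u j' hu hl
        -- Going back along one link takes at least `η / 2`, although the infimum may not be attained.
        obtain ⟨t₀, ht₀, hlt⟩ := exists_lt_of_csInf_lt hne
          (lt_add_of_pos_right (sInf (W.sendTimes P R u j' m')) (half_pos h0))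
        have ht₀' : P.LocalSends (W.party (W.src u j')) (W.input (W.src u j'))
            (W.start (W.src u j')) (R (W.src u j')) (W.party u) m' t₀ := by
          rw [W.party_src]
          exact ht₀
        push_cast at ht
        obtain ⟨j'', m'', t', hle, hsent, hsig⟩ :=
          ih _ _ _ t₀ (hGsrc u j' hu hl) (by linarith) ht₀' hm'
        exact ⟨j'', m'', t', by linarith, hsent, hsig⟩
  obtain ⟨k, hk⟩ := exists_nat_gt ((t + c u) / (η / 2))
  exact key k u j m t hu ((div_lt_iff₀ (half_pos h0)).1 hk) hs hm

/-- A run of a network is an execution of the protocol for the parties that are honest in `S`, where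
`ν i` is the node of the honest party `i`, and the clock of node `u` is shifted by `c u`: the other
nodes belong to Byzantine parties, which may be represented by several nodes. The shifted delays have
to be positive on all links, and at most `δ` between honest parties. The nodes in `G` are those
that can influence the honest ones. -/
theorem isExecution {f : ℕ} {δ : ℝ} {S : Setting n f δ} {x : Fin n → I} {ν : Fin n → N}
    {c : N → ℝ} {G : N → Prop} (hR : W.step P lk R = R) (h0 : 0 < η) (hc : ∀ u, 0 ≤ c u)
    (hst : ∀ u j, lk u j → W.start u ≤ W.start (W.src u j) + W.delay u j)
    (hparty : ∀ i, W.party (ν i) = i)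
    (hstart : ∀ i ∈ S.honest, S.start i = W.start (ν i) + c (ν i))
    (hx : ∀ i ∈ S.honest, x i = W.input (ν i))
    (hG : ∀ i ∈ S.honest, G (ν i))
    (hGsrc : ∀ u j, G u → lk u j → G (W.src u j))
    (hGν : ∀ u, G u → W.party u ∈ S.honest → u = ν (W.party u))
    (hpos : ∀ u j, G u → lk u j → η ≤ W.delay u j + c u - c (W.src u j))
    (hlink : ∀ i ∈ S.honest, ∀ j ∈ S.honest,
      lk (ν i) j ∧ W.delay (ν i) j + c (ν i) - c (ν j) ≤ δ) :
    P.IsExecution S x (fun i => Protocol.shiftReceipts (c (ν i)) (R (ν i))) := by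
  have hsrc : ∀ i ∈ S.honest, ∀ j ∈ S.honest, W.src (ν i) j = ν j := by
    intro i hi j hj
    have := hGν _ (hGsrc _ j (hG i hi) (hlink i hi j hj).1) (by rwa [W.party_src])
    rwa [W.party_src] at this
  have hsends : ∀ k ∈ S.honest, ∀ j m t,
      P.Sends S x (fun i => Protocol.shiftReceipts (c (ν i)) (R (ν i))) k j m t ↔
        P.LocalSends k (W.input (ν k)) (W.start (ν k)) (R (ν k)) j m (t - c (ν k)) := by
    intro k hk j m t
    rw [P.sends_iff_localSends, hstart k hk, hx k hk, Protocol.localSends_shift]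
  have hrcv : ∀ i ∈ S.honest, ∀ j m r,
      Protocol.shiftReceipts (c (ν i)) (R (ν i)) j m = some r →
        lk (ν i) j ∧ (W.sendTimes P R (ν i) j m).Nonempty ∧
          r = sInf (W.sendTimes P R (ν i) j m) + W.delay (ν i) j + c (ν i) := by
    intro i hi j m r hr
    obtain ⟨r', hr', rfl⟩ := Option.map_eq_some_iff.1 hr
    rw [← hR] at hr'
    obtain ⟨h1, h2, h3⟩ := step_eq_some.1 hr'
    exact ⟨h1, h2, by rw [h3]⟩
  have hsent : ∀ i ∈ S.honest, ∀ j m r,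
      Protocol.shiftReceipts (c (ν i)) (R (ν i)) j m = some r →
        ∃ t ∈ W.sendTimes P R (ν i) j m, t + c (W.src (ν i) j) ≤ r := by
    intro i hi j m r hr
    obtain ⟨hl, hne, rfl⟩ := hrcv i hi j m r hr
    have hp := hpos (ν i) j (hG i hi) hl
    obtain ⟨t, ht, hlt⟩ := exists_lt_of_csInf_lt hne
      (lt_add_of_pos_right (sInf (W.sendTimes P R (ν i) j m)) h0)
    exact ⟨t, ht, by linarith⟩
  refine ⟨?_, ?_, ?_, ?_⟩
  · intro i hi j m r hr
    obtain ⟨hl, hne, rfl⟩ := hrcv i hi j m r hr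
    have h1 := hst _ _ hl
    have h2 := le_csInf hne start_mem_lowerBounds
    rw [hstart i hi]
    linarith
  · intro i hi j hj m t hs
    have hmem : t - c (ν j) ∈ W.sendTimes P R (ν i) j m := by
      rw [sendTimes, mem_ofPred_eq, hsrc i hi j hj, hparty]
      exact (hsends j hj i m t).1 hs
    obtain ⟨hl, hd⟩ := hlink i hi j hj
    have hr : R (ν i) j m = some (sInf (W.sendTimes P R (ν i) j m) + W.delay (ν i) j) := by
      conv_lhs => rw [← hR]
      exact step_eq_some.2 ⟨hl, ⟨_, hmem⟩, rfl⟩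
    have hle := csInf_le bddBelow_sendTimes hmem
    exact ⟨_, Option.map_eq_some_iff.2 ⟨_, hr, rfl⟩, by linarith⟩
  · intro i hi j hj m r hr
    obtain ⟨t, ht, hle⟩ := hsent i hi j m r hr
    rw [sendTimes, mem_ofPred_eq, hsrc i hi j hj, hparty] at ht
    rw [hsrc i hi j hj] at hle
    exact ⟨t + c (ν j), hle, (hsends j hj i m _).2 (by rwa [add_sub_cancel_right])⟩
  · intro i hi j m r hr k hk s hs
    obtain ⟨t, ht, hle⟩ := hsent i hi j m r hr
    have ht' : P.LocalSends (W.party (W.src (ν i) j)) (W.input (W.src (ν i) j))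
        (W.start (W.src (ν i) j)) (R (W.src (ν i) j)) (W.party (ν i)) m t := by
      rw [W.party_src]
      exact ht
    obtain ⟨j', m', t', hle', hsent', hsig⟩ := exists_sent_of_mem_sigs hR h0 hc hGsrc hGν hpos
      (hGsrc _ j (hG i hi) (hrcv i hi j m r hr).1) ht' hk hs
    exact ⟨j', m', t' + c (ν k), by linarith,
      (hsends k hk j' m' _).2 (by rwa [add_sub_cancel_right]), hsig⟩

end Network

/-! ### The lower bound: the parties and their camps -/

namespace LowerBound

/-- The role of a party in the lower bound: the broadcaster, the only party of camp `β` that has to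
commit early, another party of camp `β`, or none of these. -/
inductive Role
  | leader
  | solo (β : Bool)
  | crowd (β : Bool)
  | rest
  deriving DecidableEq

/-- The camp to which a party belongs; the broadcaster and the rest have one face in each camp. -/
def Role.camp : Role → Option Bool
  | leader => none
  | solo β => some β
  | crowd β => some β
  | rest => none

/-- One party is `solo β` and `f - 1` parties are `crowd β` in each camp; as `n ≤ 3 * f - 1`, both
the opposite camp and the set of `leader`, `solo (!β)`, `rest` are small enough to be Byzantine. -/
theorem exists_role {n f : ℕ} (hn : 2 * f + 1 ≤ n) (hn' : n + 1 ≤ 3 * f) (L : Fin n) :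
    ∃ role : Fin n → Role, (∀ i, role i = .leader ↔ i = L) ∧
      (∀ β, ∃ i, role i = .solo β) ∧ (∀ β, ∃ i, role i = .crowd β) ∧
      (∀ β, (Finset.univ.filter fun i => (role i).camp = some β).card ≤ f) ∧
      ∀ β, (Finset.univ.filter fun i => (role i).camp = none ∨ role i = .solo β).card ≤ f := by
  have : NeZero n := ⟨by omega⟩
  let g : ℕ → Role := fun k =>
    if k = 0 then .leader else if k = 1 then .solo false else if k = 2 then .solo true
    else if k < f + 2 then .crowd false else if k < 2 * f + 1 then .crowd true else .rest
  let e : Equiv.Perm (Fin n) := Equiv.swap L 0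
  have hex : ∀ k (_ : k < n), ∃ i, g (e i) = g k := fun k hk =>
    ⟨e.symm ⟨k, hk⟩, by rw [Equiv.apply_symm_apply]⟩
  have hcard : ∀ (p : Role → Prop) [DecidablePred p] (T : Finset ℕ),
      (∀ k < n, p (g k) → k ∈ T) → T.card ≤ f →
        (Finset.univ.filter fun i => p (g (e i))).card ≤ f := by
    intro p _ T hT hTf
    refine le_trans (Finset.card_le_card_of_injOn (fun i => (e i : ℕ)) ?_ ?_) hTf
    · intro i hi
      simp only [Finset.coe_filter, Finset.mem_univ, true_and, mem_ofPred_eq] at hi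
      exact hT _ (e i).2 hi
    · exact fun i _ j _ h => e.injective (Fin.ext h)
  refine ⟨fun i => g (e i), ?_, ?_, ?_, ?_, ?_⟩
  · intro i
    have h1 : g (e i) = .leader ↔ (e i : ℕ) = 0 := by
      simp only [g]
      split_ifs <;> simp_all
    rw [h1, Fin.val_eq_zero_iff, ← Equiv.swap_apply_left L 0]
    exact e.injective.eq_iff
  · rintro (_ | _)
    · exact hex 1 (by omega)
    · exact hex 2 (by omega)
  · rintro (_ | _)
    · obtain ⟨i, hi⟩ := hex 3 (by omega)
      refine ⟨i, hi.trans ?_⟩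
      simp only [g]
      rw [if_neg (by omega), if_neg (by omega), if_neg (by omega), if_pos (by omega)]
    · obtain ⟨i, hi⟩ := hex (f + 2) (by omega)
      refine ⟨i, hi.trans ?_⟩
      simp only [g]
      rw [if_neg (by omega), if_neg (by omega), if_neg (by omega), if_neg (by omega),
        if_pos (by omega)]
  · rintro (_ | _)
    · refine hcard (fun ρ => ρ.camp = some false) (insert 1 (Finset.Ico 3 (f + 2))) ?_ ?_
      · intro k _ hk
        simp only [g] at hk
        split_ifs at hk <;> simp_all [Role.camp]
        omega
      · refine (Finset.card_insert_le _ _).trans ?_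
        rw [Nat.card_Ico]
        omega
    · refine hcard (fun ρ => ρ.camp = some true) (insert 2 (Finset.Ico (f + 2) (2 * f + 1))) ?_ ?_
      · intro k _ hk
        simp only [g] at hk
        split_ifs at hk <;> simp_all [Role.camp]
      · refine (Finset.card_insert_le _ _).trans ?_
        rw [Nat.card_Ico]
        omega
  · intro β
    refine hcard (fun ρ => ρ.camp = none ∨ ρ = .solo β)
      (insert 0 (insert (if β then 2 else 1) (Finset.Ico (2 * f + 1) n))) ?_ ?_
    · intro k _ hk
      simp only [g] at hk
      cases β <;> split_ifs at hk <;> simp_all [Role.camp]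
    · refine (Finset.card_insert_le _ _).trans ?_
      refine (Nat.add_le_add_right (Finset.card_insert_le _ _) 1).trans ?_
      rw [Nat.card_Ico]
      omega

/-! ### The lower bound: the network with two camps -/

variable {n : ℕ} {V : Type u}

/-- The face of party `i` seen in camp `β`. -/
def face (role : Fin n → Role) (β : Bool) (i : Fin n) : Fin n × Bool :=
  (i, (role i).camp.getD β)

/-- The network with two camps. In camp `β` the broadcaster has input `v β` and starts at time `0`,
the other parties start at time `δ`, and all delays are `δ`. Messages between the camps are slower:
they take `Δ + h` to the solo party and `Δ - h` to the crowd. -/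
def twoCamps (role : Fin n → Role) (L : Fin n) (v : Bool → V) {δ : ℝ} (hδ : 0 ≤ δ) (Δ h : ℝ) :
    Network n (Option V) (Fin n × Bool) where
  party := Prod.fst
  start u := if u.1 = L then 0 else δ
  input u := if u.1 = L then some (v u.2) else none
  src u j := face role u.2 j
  delay u j :=
    if (role j).camp.getD u.2 = u.2 then δ
    else if role u.1 = .solo u.2 then Δ + h else Δ - h
  party_src _ _ := rfl
  start_nonneg u := by split_ifs <;> simp [hδ]

/-- The links inside the camps. -/
def campLinks (role : Fin n → Role) (u : Fin n × Bool) (j : Fin n) : Prop :=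
  (role j).camp.getD u.2 = u.2

/-- All links: those inside the camps, and those between members of different camps, except the
two solo parties. -/
def allLinks (role : Fin n → Role) (u : Fin n × Bool) (j : Fin n) : Prop :=
  campLinks role u j ∨ (role u.1).camp = some u.2 ∧ (role j).camp = some (!u.2) ∧
    ¬ (role u.1 = .solo u.2 ∧ role j = .solo (!u.2))

section twoCamps

variable {role : Fin n → Role} {L : Fin n} {v : Bool → V} {f : ℕ} {δ Δ h : ℝ}

theorem not_leader_of_camp (hL : ∀ i, role i = .leader ↔ i = L) {i : Fin n} {β : Bool}
    (hi : (role i).camp = some β) : i ≠ L := by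
  intro h
  rw [(hL i).2 h] at hi
  cases hi

theorem delay_of_campLinks {hδ : 0 ≤ δ} {u : Fin n × Bool} {j : Fin n} (hl : campLinks role u j) :
    (twoCamps role L v hδ Δ h).delay u j = δ :=
  if_pos hl

theorem src_of_campLinks {hδ : 0 ≤ δ} {u : Fin n × Bool} {j : Fin n} (hl : campLinks role u j) :
    (twoCamps role L v hδ Δ h).src u j = (j, u.2) :=
  Prod.ext rfl hl

theorem delay_of_camp_eq_not {hδ : 0 ≤ δ} {u : Fin n × Bool} {j : Fin n}
    (hj : (role j).camp = some (!u.2)) :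
    (twoCamps role L v hδ Δ h).delay u j = if role u.1 = .solo u.2 then Δ + h else Δ - h := by
  refine if_neg ?_
  simp [hj]

theorem src_of_camp_eq_not {hδ : 0 ≤ δ} {u : Fin n × Bool} {j : Fin n}
    (hj : (role j).camp = some (!u.2)) :
    (twoCamps role L v hδ Δ h).src u j = (j, !u.2) :=
  Prod.ext rfl (by simp [twoCamps, face, hj])

/-- The broadcaster starts `δ` early, so that no message arrives before its receiver has started. -/
theorem start_le_start_src_add (hL : ∀ i, role i = .leader ↔ i = L) (hδ : 0 ≤ δ) (hh : h ≤ Δ)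
    (u : Fin n × Bool) (j : Fin n) (hl : allLinks role u j) (hh0 : 0 ≤ h) :
    (twoCamps role L v hδ Δ h).start u ≤
      (twoCamps role L v hδ Δ h).start ((twoCamps role L v hδ Δ h).src u j) +
        (twoCamps role L v hδ Δ h).delay u j := by
  rcases hl with hl | ⟨-, hj, -⟩
  · rw [delay_of_campLinks hl, src_of_campLinks hl]
    simp only [twoCamps]
    split_ifs <;> linarith
  · rw [delay_of_camp_eq_not hj, src_of_camp_eq_not hj]
    simp only [twoCamps, not_leader_of_camp hL hj, if_false]
    split_ifs <;> linarith

/-- The good case in camp `β`: the broadcaster is honest with input `v β`, and the other camp is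
Byzantine and silent. -/
def goodSetting (role : Fin n → Role) (L : Fin n) (β : Bool) (hδ : 0 ≤ δ)
    (hcard : (Finset.univ.filter fun i => (role i).camp = some !β).card ≤ f) :
    Setting n f δ where
  honest := Finset.univ.filter fun i => (role i).camp ≠ some !β
  card_honest := by
    have := Finset.card_filter_add_card_filter_not (s := (Finset.univ : Finset (Fin n)))
      (fun i => (role i).camp = some !β)
    rw [Finset.card_univ, Fintype.card_fin] at this
    simp only [ne_eq]
    omega
  start i := if i = L then 0 else δ
  skew i _ j _ := by split_ifs <;> simp [abs_of_nonneg, hδ]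

/-- The clock shift by `h` of the camp opposite to `β`. -/
def clockShift (h : ℝ) (β : Bool) (u : Fin n × Bool) : ℝ :=
  if u.2 = β then 0 else h

theorem clockShift_mem {β : Bool} {u : Fin n × Bool} (hh : 0 ≤ h) :
    clockShift h β u ∈ Icc 0 h := by
  unfold clockShift
  split_ifs <;> simp [hh]

theorem clockShift_not (h : ℝ) (β : Bool) (u : Fin n × Bool) (j : Fin n) :
    clockShift h β (j, !u.2) = h - clockShift h β u := by
  unfold clockShift
  rcases u with ⟨i, γ⟩
  cases β <;> cases γ <;> simp

/-- The split case: the solo party of camp `β` and both crowds are honest, and the clocks of the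
other camp are set forward by `h`. -/
def splitSetting (role : Fin n → Role) (β : Bool) (δ : ℝ) (hh : 0 ≤ h) (hΔ : h ≤ Δ)
    (hcard : (Finset.univ.filter fun i =>
      (role i).camp = none ∨ role i = .solo !β).card ≤ f) :
    Setting n f Δ where
  honest := Finset.univ.filter fun i => ¬ ((role i).camp = none ∨ role i = .solo !β)
  card_honest := by
    have := Finset.card_filter_add_card_filter_not (s := (Finset.univ : Finset (Fin n)))
      (fun i => (role i).camp = none ∨ role i = .solo !β)
    rw [Finset.card_univ, Fintype.card_fin] at this
    omega
  start i := δ + clockShift h β (face role β i)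
  skew i _ j _ := by
    unfold clockShift
    split_ifs <;> simp [abs_of_nonneg, hh, hΔ, hh.trans hΔ]

variable {P : Protocol.{u, w} n (Option V) (Option V)}
  {R R' : Fin n × Bool → Fin n → P.Msg → Option ℝ}

theorem camp_getD_eq_of_ne {i : Fin n} {β : Bool} (hi : (role i).camp ≠ some !β) :
    (role i).camp.getD β = β := by
  rcases hc : (role i).camp with _ | γ
  · rfl
  · cases β <;> cases γ <;> simp_all

/-- The run of camp `β` alone is a good case with delay bound `δ`. -/
theorem isExecution_goodSetting (hL : ∀ i, role i = .leader ↔ i = L) (hδ : 0 < δ)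
    (hh : 0 ≤ h) (hΔ : h ≤ Δ) (β : Bool)
    (hcard : (Finset.univ.filter fun i => (role i).camp = some !β).card ≤ f)
    (hR : (twoCamps role L v hδ.le Δ h).step P (campLinks role) R = R) :
    P.IsExecution (goodSetting role L β hδ.le hcard)
      (fun i => if i = L then some (v β) else none)
      (fun i => Protocol.shiftReceipts 0 (R (i, β))) := by
  have hhon : ∀ i, i ∈ (goodSetting role L β hδ.le hcard).honest ↔ (role i).camp ≠ some !β := by
    simp [goodSetting]
  refine Network.isExecution (W := twoCamps role L v hδ.le Δ h) (ν := fun i => (i, β))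
    (c := fun _ => 0) (G := fun u => u.2 = β) hR hδ (fun _ => le_rfl) ?_ (fun _ => rfl)
    ?_ ?_ (fun _ _ => rfl) ?_ ?_ ?_ ?_
  · exact fun u j hl => start_le_start_src_add hL hδ.le hΔ u j (Or.inl hl) hh
  · exact fun i _ => (add_zero _).symm
  · exact fun i _ => rfl
  · intro u j hu hl
    rw [src_of_campLinks hl]
    exact hu
  · exact fun u hu _ => Prod.ext rfl hu
  · intro u j _ hl
    rw [delay_of_campLinks hl]
    simp
  · intro i hi j hj
    have hl : campLinks role (i, β) j := camp_getD_eq_of_ne ((hhon j).1 hj)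
    rw [delay_of_campLinks hl]
    exact ⟨hl, by simp⟩

/-- The run with all links is a split case with delay bound `Δ`, for each of the two shifts: messages
between honest parties of different camps take `Δ` or `Δ - 2 * h` in it. -/
theorem isExecution_splitSetting (hL : ∀ i, role i = .leader ↔ i = L) (hδ : 0 < δ) (hδΔ : δ ≤ Δ)
    (hh : 0 ≤ h) (hΔ : 2 * h < δ) (β : Bool) (w : V) (hhΔ : h ≤ Δ)
    (hcard : (Finset.univ.filter fun i =>
      (role i).camp = none ∨ role i = .solo !β).card ≤ f)
    (hR : (twoCamps role L v hδ.le Δ h).step P (allLinks role) R = R) :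
    P.IsExecution (splitSetting role β δ hh hhΔ hcard)
      (fun i => if i = L then some w else none)
      (fun i => Protocol.shiftReceipts (clockShift h β (face role β i)) (R (face role β i))) := by
  have hhon : ∀ i ∈ (splitSetting role β δ hh hhΔ hcard).honest,
      ∃ γ, (role i).camp = some γ ∧ face role β i = (i, γ) ∧ (role i = .solo γ → γ = β) := by
    intro i hi
    simp only [splitSetting, Finset.mem_filter, Finset.mem_univ, true_and, not_or] at hi
    obtain ⟨γ, hγ⟩ := Option.ne_none_iff_exists'.1 hi.1
    refine ⟨γ, hγ, by simp [face, hγ], fun hs => ?_⟩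
    by_contra hne
    exact hi.2 (by rw [hs, Bool.eq_not_of_ne hne])
  have hη : 0 < min δ (δ - 2 * h) := lt_min hδ (by linarith)
  have hη1 := min_le_left δ (δ - 2 * h)
  have hη2 := min_le_right δ (δ - 2 * h)
  refine Network.isExecution (W := twoCamps role L v hδ.le Δ h) (ν := face role β)
    (c := clockShift h β) (G := fun u => (role u.1).camp.getD u.2 = u.2) hR hη ?_ ?_
    (fun _ => rfl) ?_ ?_ ?_ ?_ ?_ ?_ ?_
  · exact fun u => (clockShift_mem hh).1
  · exact fun u j hl => start_le_start_src_add hL hδ.le hhΔ u j hl hh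
  · intro i hi
    obtain ⟨γ, hγ, -⟩ := hhon i hi
    have := not_leader_of_camp hL hγ
    simp [splitSetting, twoCamps, face, this]
  · intro i hi
    obtain ⟨γ, hγ, -⟩ := hhon i hi
    have := not_leader_of_camp hL hγ
    simp [twoCamps, face, this]
  · intro i hi
    obtain ⟨γ, hγ, hf, -⟩ := hhon i hi
    simp [hf, hγ]
  · intro u j _ _
    simp only [twoCamps, face]
    rcases (role j).camp with _ | γ <;> rfl
  · intro u hu hi
    obtain ⟨γ, hγ, hf, -⟩ := hhon _ hi
    rw [hf]
    refine Prod.ext rfl ?_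
    rw [← hu]
    change (role u.1).camp = some γ at hγ
    simp [hγ]
  · intro u j _ hl
    rcases hl with hl | ⟨-, hj, -⟩
    · rw [delay_of_campLinks hl, src_of_campLinks hl]
      simp only [clockShift]
      linarith
    · rw [delay_of_camp_eq_not hj, src_of_camp_eq_not hj]
      have hc := clockShift_mem (β := β) (u := u) hh
      rw [clockShift_not h β u j]
      split_ifs <;> linarith [hc.1, hc.2]
  · intro i hi j hj
    obtain ⟨γ, hγ, hf, hs⟩ := hhon i hi
    obtain ⟨γ', hγ', hf', hs'⟩ := hhon j hj
    rw [hf, hf']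
    by_cases hγγ : γ' = γ
    · have hl : campLinks role (i, γ) j := by simp [campLinks, hγ', hγγ]
      rw [delay_of_campLinks hl]
      refine ⟨Or.inl hl, ?_⟩
      simp only [clockShift, hγγ]
      linarith
    · obtain rfl : γ' = !γ := Bool.eq_not_of_ne hγγ
      rw [delay_of_camp_eq_not (u := (i, γ)) hγ']
      refine ⟨Or.inr ⟨hγ, hγ', fun h => ?_⟩, ?_⟩
      · exact hγγ ((hs' h.2).trans (hs h.1).symm)
      · have hc := clockShift_mem (β := β) (u := (i, γ)) hh
        rw [clockShift_not h β (i, γ) j]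
        split_ifs with hsolo
        · have h0 : clockShift h β (i, γ) = 0 := if_pos (hs hsolo)
          linarith
        · linarith [hc.1, hc.2]

/-- Before `δ + Δ + h`, the solo party of camp `β` cannot tell whether the other camp exists: the
members of the other camp start at time `δ`, and their messages reach the solo party from `δ + Δ + h`
on and the crowd from `δ + Δ - h` on; what the crowd then sends takes another `δ ≥ 2 * h`. -/
theorem agreeBelow_solo (hL : ∀ i, role i = .leader ↔ i = L) (hδ : 0 < δ) (hδΔ : δ ≤ Δ)
    (hh : 0 ≤ h) (hΔ : 2 * h < δ)
    (hR : (twoCamps role L v hδ.le Δ h).step P (campLinks role) R = R)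
    (hR' : (twoCamps role L v hδ.le Δ h).step P (allLinks role) R' = R')
    {a : Fin n} {β : Bool} (ha : role a = .solo β) :
    Protocol.AgreeBelow (R (a, β)) (R' (a, β)) (δ + Δ + h) := by
  have hη : 0 < min δ (δ - h) := lt_min hδ (by linarith)
  have hη1 := min_le_left δ (δ - h)
  have hη2 := min_le_right δ (δ - h)
  have key := Network.agreeBelow_of_links (G := fun u => (role u.1).camp.getD u.2 = u.2)
    (θ := fun u => if role u.1 = .crowd u.2 then δ + Δ - h else δ + Δ + h)
    (η := min δ (δ - h)) ?_ hη hR hR' ?_ (a, β) (by simp [ha, Role.camp])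
  · simpa [ha] using key
  · intro u j
    simp only [twoCamps]
    split_ifs <;> linarith
  · intro u j hu
    by_cases hl : campLinks role u j
    · refine Or.inl ⟨⟨Or.inl, fun _ => hl⟩, ?_, ?_⟩
      · rw [src_of_campLinks hl]
        exact hl
      · rw [delay_of_campLinks hl, src_of_campLinks hl]
        split_ifs <;> linarith
    · refine Or.inr ⟨hl, ?_⟩
      rintro (hl' | ⟨hu', hj, -⟩)
      · exact absurd hl' hl
      · rw [delay_of_camp_eq_not hj, src_of_camp_eq_not hj]
        simp only [twoCamps, not_leader_of_camp hL hj, if_false]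
        rcases hr : role u.1 with _ | γ | γ | _ <;> simp_all [Role.camp] <;> linarith

end twoCamps

/-- No protocol commits earlier than `Δ + 3 / 2 * δ` in all good cases. Otherwise the two solo parties
commit different values in the two split cases, with which the crowds then have to agree,
although the two split cases look the same to them. -/
theorem isOptimalGoodCaseLatency {n f : ℕ} (V : Type u) [Nontrivial V] {Δ : ℝ}
    (hn : 2 * f + 1 ≤ n) (hn' : n + 1 ≤ 3 * f) (L : Fin n) :
    IsOptimalGoodCaseLatency.{u, w} V f L Δ (fun δ => Δ + 3 / 2 * δ) := by
  intro P hP T' hT δ hδmem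
  obtain ⟨hδ, hδΔ⟩ := id hδmem
  by_contra! hlt
  obtain ⟨v₀, v₁, hne⟩ := exists_pair_ne V
  let v : Bool → V := fun β => if β then v₁ else v₀
  obtain ⟨role, hL, hsolo, hcrowd, hcard, hcard'⟩ := exists_role hn hn' L
  -- The gap leaves room for a clock shift below `δ / 2`, so that all delays are positive.
  obtain ⟨h, hh, hΔ, hTh⟩ : ∃ h, 0 ≤ h ∧ 2 * h < δ ∧ T' δ < δ + Δ + h := by
    obtain ⟨h, h1, h2⟩ := exists_between
      (max_lt (half_pos hδ) (by linarith : T' δ - δ - Δ < δ / 2))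
    exact ⟨h, (le_max_left _ _).trans h1.le, by linarith,
      by linarith [(le_max_right (0 : ℝ) (T' δ - δ - Δ)).trans_lt h1]⟩
  have hhΔ : h ≤ Δ := by linarith
  have hη : 0 < min δ (δ - h) := lt_min hδ (by linarith)
  have hdelay : ∀ u j, min δ (δ - h) ≤ (twoCamps role L v hδ.le Δ h).delay u j := by
    intro u j
    have := min_le_left δ (δ - h)
    have := min_le_right δ (δ - h)
    simp only [twoCamps]
    split_ifs <;> linarith
  obtain ⟨R, hR⟩ := Network.exists_step_eq (P := P) hdelay hη (campLinks role)
  obtain ⟨R', hR'⟩ := Network.exists_step_eq (P := P) hdelay hη (allLinks role)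
  obtain ⟨p, hp⟩ := hcrowd true
  have hcommit : ∀ (β : Bool), ∃ t,
      P.LocalCommits p none δ (R' (p, true)) (some (v β)) t := by
    intro β
    obtain ⟨a, ha⟩ := hsolo β
    have haL : a ≠ L := not_leader_of_camp hL (by rw [ha]; rfl)
    -- In the good case the solo party of camp `β` commits `v β` early.
    have hgood := isExecution_goodSetting hL hδ hh hhΔ β (hcard !β) hR
    have hmem : ∀ i, i ∈ (goodSetting role L β hδ.le (hcard !β)).honest ↔
        (role i).camp ≠ some !β := by simp [goodSetting]
    have hLmem : L ∈ (goodSetting role L β hδ.le (hcard !β)).honest := by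
      rw [hmem, (hL L).2 rfl]
      simp [Role.camp]
    have hamem : a ∈ (goodSetting role L β hδ.le (hcard !β)).honest := by
      rw [hmem, ha]
      simp [Role.camp]
    obtain ⟨s, hs⟩ := ((hP δ ⟨hδ.le, hδΔ⟩ _ ⟨_, v β, _, hgood, rfl⟩).2.1 hLmem a hamem).1
    obtain ⟨o, t, ht, hle⟩ := hT δ ⟨hδ.le, hδΔ⟩ _ ⟨_, v β, _, hgood, rfl⟩ hLmem a hamem
    have hloc : P.LocalCommits a none δ (R (a, β)) (some (v β)) t := by
      have h1 := (P.commits_iff_localCommits _ _ _ _ _ _).1 ht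
      have h2 := (P.commits_iff_localCommits _ _ _ _ _ _).1 hs
      rw [h1.unique h2] at h1
      have h3 : (goodSetting role L β hδ.le (hcard !β)).start a = δ + 0 := by
        simp [goodSetting, haL]
      rw [h3, Protocol.localCommits_shift, sub_zero, if_neg haL] at h1
      exact h1
    have htle : t ≤ T' δ := by
      simpa [goodSetting] using hle
    -- It cannot tell the split case from the good case, and the crowd has to agree with it.
    have hloc' := (agreeBelow_solo hL hδ hδΔ hh hΔ hR hR' ha).localCommits
      (htle.trans_lt hTh) hloc
    have hsplit := isExecution_splitSetting hL hδ hδΔ hh hΔ β (v β) hhΔ (hcard' !β) hR'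
    have hmem' : ∀ i, i ∈ (splitSetting role β δ hh hhΔ (hcard' !β)).honest ↔
        ¬ ((role i).camp = none ∨ role i = .solo !β) := by simp [splitSetting]
    have hamem' : a ∈ (splitSetting role β δ hh hhΔ (hcard' !β)).honest := by
      rw [hmem', ha]
      simp [Role.camp]
    have hpmem' : p ∈ (splitSetting role β δ hh hhΔ (hcard' !β)).honest := by
      rw [hmem', hp]
      simp [Role.camp]
    obtain ⟨hagree, -, hterm⟩ := hP Δ ⟨hδ.le.trans hδΔ, le_rfl⟩ _ ⟨_, v β, _, hsplit, rfl⟩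
    obtain ⟨o', t', ht'⟩ := (hterm p hpmem').1
    have hface : face role β a = (a, β) := by simp [face, ha, Role.camp]
    have hface' : face role β p = (p, true) := by simp [face, hp, Role.camp]
    have hac : P.Commits (splitSetting role β δ hh hhΔ (hcard' !β))
        (fun i => if i = L then some (v β) else none)
        (fun i => Protocol.shiftReceipts (clockShift h β (face role β i)) (R' (face role β i)))
        a (some (v β)) (t + clockShift h β (face role β a)) := by
      rw [P.commits_iff_localCommits, if_neg haL]
      refine (Protocol.localCommits_shift _ _ _ _ _ _ _).2 ?_
      rwa [add_sub_cancel_right, hface]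
    have ho' := hagree p hpmem' a hamem' _ _ _ _ ht' hac
    have hpL : p ≠ L := not_leader_of_camp hL (by rw [hp]; rfl)
    have h1 := (P.commits_iff_localCommits _ _ _ _ _ _).1 ht'
    rw [if_neg hpL, ho'] at h1
    have h2 := (Protocol.localCommits_shift _ _ _ _ _ _ _).1 h1
    rw [hface'] at h2
    exact ⟨_, h2⟩
  obtain ⟨t, ht⟩ := hcommit false
  obtain ⟨t', ht'⟩ := hcommit true
  exact hne (by simpa [v] using ht.unique ht')

end LowerBound

end

theorem mainTheorem4 {n f : ℕ} {V : Type u} {Δ : ℝ} (hΔ : 0 < Δ)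
    (hf_lower : (n : ℝ) / 3 < f) (hf_upper : (f : ℝ) < n / 2) (L : Fin n)
    (BA : Protocol.{u, w} n (Option V) (Option V)) (hBA : BA.SolvesByzantineAgreement f Δ) :
    SolvesByzantineBroadcast L Δ (DeltaBB.runs BA f Δ L) ∧
      HasGoodCaseLatency L Δ (DeltaBB.runs BA f Δ L) (fun δ => Δ + 3 / 2 * δ) ∧
      (Nontrivial V → IsOptimalGoodCaseLatency.{u, w} V f L Δ (fun δ => Δ + 3 / 2 * δ)) := by
  have hn : 2 * f + 1 ≤ n := by
    have : (2 * f : ℝ) < n := by linarith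
    exact_mod_cast this
  have hn' : n + 1 ≤ 3 * f := by
    have : (n : ℝ) < 3 * f := by linarith
    exact_mod_cast this
  exact ⟨DeltaBB.solvesByzantineBroadcast hn L BA hBA, DeltaBB.hasGoodCaseLatency hn L BA,
    fun _ => LowerBound.isOptimalGoodCaseLatency V hn hn' L⟩
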